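/- Let $\Bbbk$ be a field, let $\Gamma$ be an abelian group (written multiplicatively), and let $\widehat\Gamma=\operatorname{Hom}(\Gamma,\Bbbk^\times)$, with trivial character $\varepsilon$. Let $V$ be a Yetter–Drinfeld module over the group algebra $\Bbbk\Gamma$, with action $h\otimes v\mapsto h\cdot v$ and coaction $\delta\colon V\to\Bbbk\Gamma\otimes V$, that has a basis $x_1,\dots,x_n$ such that, for some $g_1,\dots,g_n\in\Gamma$ and $\chi_1,\dots,\chi_n\in\widehat\Gamma$, $$h\cdot x_j=\chi_j(h)\,x_j\quad(h\in\Gamma),\qquad \delta(x_j)=g_j\otimes x_j,\qquad 1\le j\le n .$$ Let $\mathfrak B(V)$ be the Nichols algebra of $V$, that is, the quotient of the tensor algebra $T(V)$, regarded as a braided Hopf algebra in the category of Yetter–Drinfeld modules over $\Bbbk\Gamma$ in which the elements of $V$ are primitive, by its largest Yetter–Drinfeld Hopf ideal generated by homogeneous elements of degree at least $2$. Let $\mathfrak B(V)\#\Bbbk\Gamma$ be its bosonization: the Hopf algebra with underlying vector space $\mathfrak B(V)\otimes\Bbbk\Gamma$ and, for $r,s\in\mathfrak B(V)$ and $\gamma,\gamma'\in\Gamma$,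 $$(r\#\gamma)(s\#\gamma')=r(\gamma\cdot s)\#\gamma\gamma',\qquad \Delta(r\#\gamma)=r^{(1)}\#(r^{(2)})_{(-1)}\gamma\otimes(r^{(2)})_{(0)}\#\gamma .$$ Suppose that $\chi_i\ne\varepsilon$ for all $i$, and that $(g_i,\chi_i)\ne(g_j,\chi_j)$ for all $i\ne j$. Then there is a bijection $\Phi\mapsto(\phi,\psi)$ from the set of Hopf algebra automorphisms of $\mathfrak B(V)\#\Bbbk\Gamma$ onto the set of pairs $(\phi,\psi)$, where $\psi$ is a group automorphism of $\Gamma$ and $\phi\colon V\to V$ is a linear isomorphism for which there are $\lambda_1,\dots,\lambda_n\in\Bbbk^\times$ and $\sigma\in\mathbb S_n$ with $$\phi(x_i)=\lambda_i x_{\sigma(i)},\qquad \psi(g_i)=g_{\sigma(i)},\qquad \chi_i=\chi_{\sigma(i)}\circ\psi,\qquad 1\le i\le n .$$ The bijection is such that $\Phi(v\#1)=\phi(v)\#1$ for all $v\in V$ and $\Phi(1\#\gamma)=1\#\psi(\gamma)$ for all $\gamma\in\Gamma$. -/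

import Mathlib

open scoped TensorProduct

/-- A (left-left) Yetter-Drinfeld module structure on the vector space `V` over the Hopf algebra
`H = kΓ`, for an abelian group `Γ`. An `H`-module is a representation of `Γ`. Since `Γ` is abelian
and its elements `γ` are group-like with `S γ = γ⁻¹`, the compatibility
`δ(h.v) = h₁ v₋₁ S(h₃) ⊗ h₂.v₀` says that `δ(γ.v) = v₋₁ ⊗ γ.v₀`. -/
structure YDModule (k Γ V : Type*) [Field k] [CommGroup Γ] [AddCommGroup V] [Module k V] where
  /-- the action of `Γ` -/
  act : Representation k Γ V
  /-- the coaction `δ : V → kΓ ⊗ V` -/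
  coact : V →ₗ[k] MonoidAlgebra k Γ ⊗[k] V
  coact_coassoc : ∀ v : V,
    TensorProduct.assoc k (MonoidAlgebra k Γ) (MonoidAlgebra k Γ) V
      ((Coalgebra.comul (R := k) (A := MonoidAlgebra k Γ)).rTensor V (coact v)) =
    coact.lTensor (MonoidAlgebra k Γ) (coact v)
  coact_counit : ∀ v : V,
    TensorProduct.lid k V
      ((Coalgebra.counit (R := k) (A := MonoidAlgebra k Γ)).rTensor V (coact v)) = v
  coact_act : ∀ (γ : Γ) (v : V),
    coact (act γ v) = (act γ).lTensor (MonoidAlgebra k Γ) (coact v)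

namespace YDModule

noncomputable section

variable {k Γ V : Type*} [Field k] [CommGroup Γ] [AddCommGroup V] [Module k V]

theorem span_homogeneous (M : YDModule k Γ V) :
    Submodule.span k {v : V | ∃ g : Γ, M.coact v = MonoidAlgebra.single g 1 ⊗ₜ[k] v} = ⊤ := by
  classical
  rw [eq_top_iff]
  rintro v -
  have key : ∀ z : MonoidAlgebra k Γ ⊗[k] V, ∃ f : Γ →₀ V,
      z = f.sum fun g w => MonoidAlgebra.single g (1 : k) ⊗ₜ[k] w := by
    intro z
    induction z using TensorProduct.induction_on with
    | zero => exact ⟨0, by simp⟩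
    | add x y hx hy =>
      obtain ⟨f, rfl⟩ := hx
      obtain ⟨f', rfl⟩ := hy
      refine ⟨f + f', ?_⟩
      rw [Finsupp.sum_add_index'] <;> simp [TensorProduct.tmul_add]
    | tmul a w =>
      induction a using MonoidAlgebra.induction_linear with
      | zero => exact ⟨0, by simp⟩
      | add x y hx hy =>
        obtain ⟨f, hf⟩ := hx
        obtain ⟨f', hf'⟩ := hy
        refine ⟨f + f', ?_⟩
        rw [TensorProduct.add_tmul, hf, hf', Finsupp.sum_add_index'] <;>
          simp [TensorProduct.tmul_add]
      | single g c =>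
        refine ⟨Finsupp.single g (c • w), ?_⟩
        rw [Finsupp.sum_single_index (by simp), ← TensorProduct.smul_tmul]
        simp
  obtain ⟨f, hf⟩ := key (M.coact v)
  have h1 := M.coact_coassoc v
  have h2 := M.coact_counit v
  rw [hf] at h1 h2
  simp only [Finsupp.sum, map_sum, LinearMap.rTensor_tmul, LinearMap.lTensor_tmul,
    MonoidAlgebra.comul_single, MonoidAlgebra.counit_single, CommSemiring.comul_apply,
    CommSemiring.counit_apply, TensorProduct.map_tmul, TensorProduct.assoc_tmul,
    TensorProduct.lid_tmul, one_smul, MonoidAlgebra.lsingle_apply] at h1 h2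
  rw [← h2]
  refine Submodule.sum_mem _ fun g hg => Submodule.subset_span ⟨g, ?_⟩
  let c : MonoidAlgebra k Γ →ₗ[k] k :=
    Finsupp.lapply g ∘ₗ (MonoidAlgebra.coeffLinearEquiv k).toLinearMap
  have hc : ∀ a : Γ, c (MonoidAlgebra.single a 1) = if a = g then 1 else 0 := by
    intro a
    simp [c, Finsupp.single_apply]
  have h3 := congrArg (fun z => TensorProduct.lid k _ (c.rTensor _ z)) h1
  simp only [map_sum, LinearMap.rTensor_tmul, hc, TensorProduct.lid_tmul, ite_smul, one_smul,
    zero_smul, Finset.sum_ite_eq', hg, if_true] at h3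
  exact h3.symm

/-- Linear maps that agree on the homogeneous vectors (those with `δ v = g ⊗ v`) are equal. -/
theorem hom_ext_homogeneous (M : YDModule k Γ V) {W : Type*} [AddCommGroup W] [Module k W]
    {f f' : V →ₗ[k] W}
    (h : ∀ (g : Γ) (v : V), M.coact v = MonoidAlgebra.single g 1 ⊗ₜ[k] v → f v = f' v) :
    f = f' :=
  LinearMap.ext_on M.span_homogeneous (by rintro v ⟨g, hv⟩; exact h g v hv)

/-! ### The tensor algebra as a braided bialgebra -/

/-- The action of `γ` on `T(V)` by algebra automorphisms, extending the action on `V`. -/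
def tAct (M : YDModule k Γ V) (γ : Γ) : TensorAlgebra k V →ₐ[k] TensorAlgebra k V :=
  TensorAlgebra.lift k (TensorAlgebra.ι k ∘ₗ M.act γ)

@[simp]
theorem tAct_ι (M : YDModule k Γ V) (γ : Γ) (v : V) :
    M.tAct γ (TensorAlgebra.ι k v) = TensorAlgebra.ι k (M.act γ v) := by
  simp [tAct]

theorem tAct_one (M : YDModule k Γ V) : M.tAct 1 = AlgHom.id k _ := by
  ext v; simp

theorem tAct_mul (M : YDModule k Γ V) (γ γ' : Γ) :
    M.tAct (γ * γ') = (M.tAct γ).comp (M.tAct γ') := by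
  ext v; simp

/-- The action of `Γ` on `T(V)` as a representation. -/
def tRep (M : YDModule k Γ V) : Representation k Γ (TensorAlgebra k V) where
  toFun γ := (M.tAct γ).toLinearMap
  map_one' := by rw [tAct_one]; rfl
  map_mul' γ γ' := by rw [tAct_mul]; rfl

/-- The coaction `δ : T(V) → kΓ ⊗ T(V)`: the algebra map extending the coaction of `V`. -/
def tCoact (M : YDModule k Γ V) :
    TensorAlgebra k V →ₐ[k] MonoidAlgebra k Γ ⊗[k] TensorAlgebra k V :=
  TensorAlgebra.lift k ((TensorAlgebra.ι k).lTensor (MonoidAlgebra k Γ) ∘ₗ M.coact)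

@[simp]
theorem tCoact_ι (M : YDModule k Γ V) (v : V) :
    M.tCoact (TensorAlgebra.ι k v) =
      (TensorAlgebra.ι k).lTensor (MonoidAlgebra k Γ) (M.coact v) := by
  simp [tCoact]

/-- The algebra map `kΓ ⊗ T(V) → End (T(V) ⊗ T(V))`, `h ⊗ y ↦ (u ⊗ v ↦ h.u ⊗ y v)`. -/
def tActMul (M : YDModule k Γ V) :
    MonoidAlgebra k Γ ⊗[k] TensorAlgebra k V →ₐ[k]
      Module.End k (TensorAlgebra k V ⊗[k] TensorAlgebra k V) :=
  (Module.endTensorEndAlgHom (R := k) (S := k) (A := k)).comp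
    (Algebra.TensorProduct.map M.tRep.asAlgebraHom (Algebra.lmul k (TensorAlgebra k V)))

theorem tActMul_single (M : YDModule k Γ V) (γ : Γ) (y u v : TensorAlgebra k V) :
    M.tActMul (MonoidAlgebra.single γ 1 ⊗ₜ y) (u ⊗ₜ v) = M.tAct γ u ⊗ₜ (y * v) := by
  simp only [tActMul, AlgHom.comp_apply, Algebra.TensorProduct.map_tmul,
    Representation.asAlgebraHom_single_one, Module.endTensorEndAlgHom_apply]
  rfl

/-- The multiplication of the braided tensor product `T(V) ⊗ T(V)`, twisted by the braiding
`y ⊗ u ↦ y₋₁.u ⊗ y₀`; that is, `(x ⊗ y) (u ⊗ v) = x (y₋₁.u) ⊗ y₀ v`. -/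
def braidedMul (M : YDModule k Γ V) :
    TensorAlgebra k V ⊗[k] TensorAlgebra k V →ₗ[k]
      Module.End k (TensorAlgebra k V ⊗[k] TensorAlgebra k V) :=
  TensorProduct.lift
    ((LinearMap.mul k (Module.End k (TensorAlgebra k V ⊗[k] TensorAlgebra k V))).compl₁₂
      (LinearMap.rTensorHom (TensorAlgebra k V) ∘ₗ LinearMap.mul k (TensorAlgebra k V))
      (M.tActMul.toLinearMap ∘ₗ M.tCoact.toLinearMap))

theorem braidedMul_tmul (M : YDModule k Γ V) (x y : TensorAlgebra k V) :
    M.braidedMul (x ⊗ₜ y) =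
      (LinearMap.mulLeft k x).rTensor (TensorAlgebra k V) * M.tActMul (M.tCoact y) :=
  rfl

/-- For `v ∈ V`, the left multiplication by `v ⊗ 1 + 1 ⊗ v` in the braided tensor product
`T(V) ⊗ T(V)`; extended to an algebra map `T(V) → End (T(V) ⊗ T(V))`. -/
def tComulEnd (M : YDModule k Γ V) :
    TensorAlgebra k V →ₐ[k] Module.End k (TensorAlgebra k V ⊗[k] TensorAlgebra k V) :=
  TensorAlgebra.lift k
    (M.braidedMul ∘ₗ
      ((TensorProduct.mk k (TensorAlgebra k V) (TensorAlgebra k V)).flip 1 +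
        TensorProduct.mk k (TensorAlgebra k V) (TensorAlgebra k V) 1) ∘ₗ TensorAlgebra.ι k)

theorem tComulEnd_ι (M : YDModule k Γ V) (v : V) :
    M.tComulEnd (TensorAlgebra.ι k v) =
      M.braidedMul (TensorAlgebra.ι k v ⊗ₜ 1 + 1 ⊗ₜ TensorAlgebra.ι k v) := by
  simp [tComulEnd]

/-- The comultiplication `Δ : T(V) → T(V) ⊗ T(V)`: the algebra map into the braided tensor product
with `Δ v = v ⊗ 1 + 1 ⊗ v` for `v ∈ V` (see `tComul_one`, `tComul_ι` and `tComul_mul`). -/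
def tComul (M : YDModule k Γ V) :
    TensorAlgebra k V →ₗ[k] TensorAlgebra k V ⊗[k] TensorAlgebra k V :=
  LinearMap.applyₗ (1 ⊗ₜ 1) ∘ₗ M.tComulEnd.toLinearMap

theorem tComul_one (M : YDModule k Γ V) : M.tComul 1 = 1 ⊗ₜ 1 := by
  simp [tComul]

theorem tComul_ι_mul (M : YDModule k Γ V) (v : V) (t : TensorAlgebra k V) :
    M.tComul (TensorAlgebra.ι k v * t) =
      M.braidedMul (TensorAlgebra.ι k v ⊗ₜ 1 + 1 ⊗ₜ TensorAlgebra.ι k v) (M.tComul t) := by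
  rw [← tComulEnd_ι]
  simp [tComul]

theorem braidedMul_ι (M : YDModule k Γ V) {g : Γ} {v : V}
    (hv : M.coact v = MonoidAlgebra.single g 1 ⊗ₜ v) (a b : TensorAlgebra k V) :
    M.braidedMul (TensorAlgebra.ι k v ⊗ₜ 1 + 1 ⊗ₜ TensorAlgebra.ι k v) (a ⊗ₜ b) =
      (TensorAlgebra.ι k v * a) ⊗ₜ b + M.tAct g a ⊗ₜ (TensorAlgebra.ι k v * b) := by
  simp [braidedMul_tmul, hv, tActMul_single]

theorem tComul_ι (M : YDModule k Γ V) (v : V) :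
    M.tComul (TensorAlgebra.ι k v) = TensorAlgebra.ι k v ⊗ₜ 1 + 1 ⊗ₜ TensorAlgebra.ι k v := by
  have : M.tComul ∘ₗ TensorAlgebra.ι k =
      ((TensorProduct.mk k (TensorAlgebra k V) (TensorAlgebra k V)).flip 1 +
        TensorProduct.mk k (TensorAlgebra k V) (TensorAlgebra k V) 1) ∘ₗ TensorAlgebra.ι k := by
    refine M.hom_ext_homogeneous fun g v hv => ?_
    have := M.tComul_ι_mul v 1
    rw [tComul_one, braidedMul_ι M hv] at this
    simpa using this
  simpa using LinearMap.congr_fun this v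

theorem end_ext {f f' : Module.End k (TensorAlgebra k V ⊗[k] TensorAlgebra k V)}
    (h : ∀ a b, f (a ⊗ₜ b) = f' (a ⊗ₜ b)) : f = f' :=
  TensorProduct.ext' h

theorem braidedMul_assoc_ι (M : YDModule k Γ V) (v : V)
    (X : TensorAlgebra k V ⊗[k] TensorAlgebra k V) :
    M.braidedMul (M.tComulEnd (TensorAlgebra.ι k v) X) =
      M.tComulEnd (TensorAlgebra.ι k v) * M.braidedMul X := by
  have : M.braidedMul ∘ₗ LinearMap.applyₗ X ∘ₗ M.tComulEnd.toLinearMap ∘ₗ TensorAlgebra.ι k =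
      LinearMap.mulRight k (M.braidedMul X) ∘ₗ M.tComulEnd.toLinearMap ∘ₗ
        TensorAlgebra.ι k := by
    refine M.hom_ext_homogeneous
      (W := Module.End k (TensorAlgebra k V ⊗[k] TensorAlgebra k V))
      fun g v hv => ?_
    simp only [LinearMap.comp_apply, LinearMap.applyₗ_apply_apply, LinearMap.mulRight_apply,
      AlgHom.toLinearMap_apply]
    induction X using TensorProduct.induction_on with
    | zero => simp
    | add X Y hX hY => rw [map_add, map_add, hX, hY, map_add, mul_add]
    | tmul a b =>
      rw [tComulEnd_ι, braidedMul_ι M hv, map_add, braidedMul_tmul, braidedMul_tmul,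
        braidedMul_tmul, map_mul M.tCoact, map_mul M.tActMul, tCoact_ι, hv,
        LinearMap.lTensor_tmul, ← mul_assoc, ← mul_assoc, ← add_mul]
      congr 1
      refine end_ext fun c d => ?_
      have := braidedMul_ι M hv (a * c) d
      simp only [LinearMap.add_apply, Module.End.mul_apply, LinearMap.rTensor_tmul,
        LinearMap.mulLeft_apply, tActMul_single, this, map_mul, mul_assoc]
  exact LinearMap.congr_fun this v

theorem mem_of_ι_mul_mem (C : Submodule k (TensorAlgebra k V)) (h1 : 1 ∈ C)
    (hι : ∀ v, ∀ t ∈ C, TensorAlgebra.ι k v * t ∈ C) (t : TensorAlgebra k V) : t ∈ C := by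
  suffices h : ∀ s ∈ C, t * s ∈ C by simpa using h 1 h1
  induction t using TensorAlgebra.induction with
  | algebraMap r => intro s hs; rw [← Algebra.smul_def]; exact C.smul_mem r hs
  | ι v => exact hι v
  | mul a b ha hb => intro s hs; rw [mul_assoc]; exact ha _ (hb _ hs)
  | add a b ha hb => intro s hs; rw [add_mul]; exact C.add_mem (ha _ hs) (hb _ hs)

/-- Linear maps on `T(V)` are equal if they agree on `1` and agreement at `t` implies agreement at
`v t` for `v ∈ V`. -/
theorem tensor_hom_ext {W : Type*} [AddCommGroup W] [Module k W]
    {f f' : TensorAlgebra k V →ₗ[k] W} (h1 : f 1 = f' 1)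
    (hι : ∀ v t, f t = f' t → f (TensorAlgebra.ι k v * t) = f' (TensorAlgebra.ι k v * t)) :
    f = f' :=
  LinearMap.ext fun t => mem_of_ι_mul_mem (LinearMap.eqLocus f f') h1 hι t

/-- `Δ` is multiplicative for the braided tensor product. -/
theorem tComul_mul (M : YDModule k Γ V) (s t : TensorAlgebra k V) :
    M.tComul (s * t) = M.braidedMul (M.tComul s) (M.tComul t) := by
  have key : M.braidedMul ∘ₗ M.tComul = M.tComulEnd.toLinearMap := by
    refine tensor_hom_ext
      (W := Module.End k (TensorAlgebra k V ⊗[k] TensorAlgebra k V))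
      ?_ fun v s hs => ?_
    · refine end_ext fun c d => ?_
      simp [tComul_one, braidedMul_tmul]
    · have h := M.braidedMul_assoc_ι v (M.tComul s)
      rw [LinearMap.comp_apply] at hs
      rw [LinearMap.comp_apply, tComul_ι_mul, ← tComulEnd_ι, h, hs]
      simp
  have h := LinearMap.congr_fun key s
  rw [LinearMap.comp_apply] at h
  rw [h]
  simp [tComul]

/-! ### The Nichols algebra -/

/-- The homogeneous components `V^{⊗ n}` of `T(V)`. -/
abbrev tGrading (_M : YDModule k Γ V) (n : ℕ) : Submodule k (TensorAlgebra k V) :=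
  LinearMap.range (TensorAlgebra.ι k : V →ₗ[k] TensorAlgebra k V) ^ n

/-- The two-sided ideals of `T(V)` that are generated by homogeneous elements of degree at least
two (that is, which are homogeneous and vanish in the degrees `0` and `1`), are Yetter-Drinfeld
submodules, and are coideals: `Δ(I) ⊆ I ⊗ T(V) + T(V) ⊗ I`. -/
structure IsHopfIdeal (M : YDModule k Γ V) (I : Ideal (TensorAlgebra k V)) : Prop where
  isTwoSided : I.IsTwoSided
  isHomogeneous : I.IsHomogeneous M.tGrading
  proj_eq_zero : ∀ t ∈ I, ∀ n < 2, GradedRing.proj M.tGrading n t = 0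
  act_mem : ∀ γ : Γ, ∀ t ∈ I, M.tAct γ t ∈ I
  coact_mem : ∀ t ∈ I, M.tCoact t ∈
    LinearMap.range ((I.restrictScalars k).subtype.lTensor (MonoidAlgebra k Γ))
  comul_mem : ∀ t ∈ I, M.tComul t ∈
    LinearMap.range ((I.restrictScalars k).subtype.rTensor (TensorAlgebra k V)) ⊔
      LinearMap.range ((I.restrictScalars k).subtype.lTensor (TensorAlgebra k V))

/-- The sum of all the ideals as in `IsHopfIdeal`: the defining ideal of the Nichols algebra. -/
def nicholsIdeal (M : YDModule k Γ V) : Ideal (TensorAlgebra k V) :=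
  sSup {I | M.IsHopfIdeal I}

theorem nicholsIdeal_induction (M : YDModule k Γ V) (C : Submodule k (TensorAlgebra k V))
    (h : ∀ I, M.IsHopfIdeal I → ∀ t ∈ I, t ∈ C) (t : TensorAlgebra k V)
    (ht : t ∈ M.nicholsIdeal) : t ∈ C := by
  rw [nicholsIdeal, sSup_eq_iSup'] at ht
  induction ht using Submodule.iSup_induction' with
  | mem I t ht => exact h I.1 I.2 t ht
  | zero => exact C.zero_mem
  | add x y _ _ hx hy => exact C.add_mem hx hy

theorem IsHopfIdeal.le {M : YDModule k Γ V} {I : Ideal (TensorAlgebra k V)}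
    (h : M.IsHopfIdeal I) : I ≤ M.nicholsIdeal :=
  le_sSup h

theorem lTensor_range_mono {I J : Submodule k (TensorAlgebra k V)} (h : I ≤ J)
    (P : Type*) [AddCommGroup P] [Module k P] :
    LinearMap.range (I.subtype.lTensor P) ≤ LinearMap.range (J.subtype.lTensor P) := by
  rw [← Submodule.subtype_comp_inclusion I J h, LinearMap.lTensor_comp]
  exact LinearMap.range_comp_le_range _ _

theorem rTensor_range_mono {I J : Submodule k (TensorAlgebra k V)} (h : I ≤ J)
    (P : Type*) [AddCommGroup P] [Module k P] :
    LinearMap.range (I.subtype.rTensor P) ≤ LinearMap.range (J.subtype.rTensor P) := by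
  rw [← Submodule.subtype_comp_inclusion I J h, LinearMap.rTensor_comp]
  exact LinearMap.range_comp_le_range _ _

theorem isHopfIdeal_nicholsIdeal (M : YDModule k Γ V) : M.IsHopfIdeal M.nicholsIdeal where
  isTwoSided := ⟨fun {a} b ha => M.nicholsIdeal_induction
    ((M.nicholsIdeal.restrictScalars k).comap (LinearMap.mulRight k b))
    (fun I hI t ht => hI.le (hI.isTwoSided.mul_mem_of_left b ht)) a ha⟩
  isHomogeneous := by
    rw [nicholsIdeal, sSup_eq_iSup]
    exact Ideal.IsHomogeneous.iSup₂ fun I hI => hI.isHomogeneous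
  proj_eq_zero t ht n hn := M.nicholsIdeal_induction
    (LinearMap.ker (GradedAlgebra.proj M.tGrading n))
    (fun I hI t ht => hI.proj_eq_zero t ht n hn) t ht
  act_mem γ := M.nicholsIdeal_induction
    ((M.nicholsIdeal.restrictScalars k).comap (M.tAct γ).toLinearMap)
    (fun I hI t ht => hI.le (hI.act_mem γ t ht))
  coact_mem := M.nicholsIdeal_induction
    ((LinearMap.range ((M.nicholsIdeal.restrictScalars k).subtype.lTensor
      (MonoidAlgebra k Γ))).comap M.tCoact.toLinearMap)
    (fun I hI t ht => lTensor_range_mono (I := I.restrictScalars k) hI.le _ (hI.coact_mem t ht))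
  comul_mem := M.nicholsIdeal_induction
    ((LinearMap.range ((M.nicholsIdeal.restrictScalars k).subtype.rTensor (TensorAlgebra k V)) ⊔
      LinearMap.range ((M.nicholsIdeal.restrictScalars k).subtype.lTensor
        (TensorAlgebra k V))).comap M.tComul)
    (fun I hI t ht => sup_le_sup (rTensor_range_mono (I := I.restrictScalars k) hI.le _)
      (lTensor_range_mono (I := I.restrictScalars k) hI.le _) (hI.comul_mem t ht))

instance (M : YDModule k Γ V) : M.nicholsIdeal.IsTwoSided :=
  M.isHopfIdeal_nicholsIdeal.isTwoSided

theorem algebraMapInv_eq_proj (M : YDModule k Γ V) :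
    Algebra.linearMap k (TensorAlgebra k V) ∘ₗ TensorAlgebra.algebraMapInv.toLinearMap =
      GradedAlgebra.proj M.tGrading 0 := by
  refine tensor_hom_ext ?_ fun v t _ => ?_
  · have : GradedAlgebra.proj M.tGrading 0 1 = 1 :=
      DirectSum.decompose_of_mem_same M.tGrading (SetLike.GradedOne.one_mem)
    rw [this]; simp
  · have h1 : TensorAlgebra.ι k v ∈ M.tGrading 1 := by
      simp [tGrading]
    have : GradedAlgebra.proj M.tGrading 0 (TensorAlgebra.ι k v * t) = 0 :=
      DirectSum.coe_decompose_mul_of_left_mem_of_not_le M.tGrading h1 (by norm_num)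
    rw [this]
    simp [TensorAlgebra.algebraMapInv]

/-- The Nichols algebra `𝔅(V)`: the quotient of `T(V)` by its largest Hopf ideal generated by
homogeneous elements of degree at least two. -/
def NicholsAlgebra (M : YDModule k Γ V) : Type _ :=
  TensorAlgebra k V ⧸ M.nicholsIdeal

namespace NicholsAlgebra

variable (M : YDModule k Γ V)

instance : Ring M.NicholsAlgebra :=
  inferInstanceAs (Ring (TensorAlgebra k V ⧸ M.nicholsIdeal))

instance : Algebra k M.NicholsAlgebra :=
  inferInstanceAs (Algebra k (TensorAlgebra k V ⧸ M.nicholsIdeal))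

/-- The projection `T(V) → 𝔅(V)`. -/
def mk : TensorAlgebra k V →ₐ[k] M.NicholsAlgebra :=
  Ideal.Quotient.mkₐ k M.nicholsIdeal

theorem mk_surjective : Function.Surjective (mk M) :=
  Ideal.Quotient.mkₐ_surjective k M.nicholsIdeal

theorem mk_eq_zero (t : TensorAlgebra k V) : mk M t = 0 ↔ t ∈ M.nicholsIdeal :=
  Ideal.Quotient.eq_zero_iff_mem

/-- The inclusion `V → 𝔅(V)`. -/
def ι : V →ₗ[k] M.NicholsAlgebra :=
  (mk M).toLinearMap ∘ₗ TensorAlgebra.ι k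

/-- Linear maps on `T(V)` that vanish on the defining ideal descend to `𝔅(V)`. -/
def liftLinear {W : Type*} [AddCommGroup W] [Module k W] (f : TensorAlgebra k V →ₗ[k] W)
    (hf : ∀ t ∈ M.nicholsIdeal, f t = 0) : M.NicholsAlgebra →ₗ[k] W :=
  (M.nicholsIdeal.restrictScalars k).liftQ f hf

@[simp]
theorem liftLinear_mk {W : Type*} [AddCommGroup W] [Module k W] (f : TensorAlgebra k V →ₗ[k] W)
    (hf : ∀ t ∈ M.nicholsIdeal, f t = 0) (t : TensorAlgebra k V) :
    liftLinear M f hf (mk M t) = f t :=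
  rfl

/-- Algebra maps on `T(V)` that vanish on the defining ideal descend to `𝔅(V)`. -/
def lift {B : Type*} [Ring B] [Algebra k B] (f : TensorAlgebra k V →ₐ[k] B)
    (hf : ∀ t ∈ M.nicholsIdeal, f t = 0) : M.NicholsAlgebra →ₐ[k] B :=
  Ideal.Quotient.liftₐ M.nicholsIdeal f hf

@[simp]
theorem lift_mk {B : Type*} [Ring B] [Algebra k B] (f : TensorAlgebra k V →ₐ[k] B)
    (hf : ∀ t ∈ M.nicholsIdeal, f t = 0) (t : TensorAlgebra k V) :
    lift M f hf (mk M t) = f t :=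
  rfl

variable {M} in
theorem algHom_ext {B : Type*} [Ring B] [Algebra k B] {f f' : M.NicholsAlgebra →ₐ[k] B}
    (h : ∀ v, f (ι M v) = f' (ι M v)) : f = f' := by
  have : f.comp (mk M) = f'.comp (mk M) := by
    ext v; exact h v
  ext r
  obtain ⟨t, rfl⟩ := mk_surjective M r
  exact DFunLike.congr_fun this t

/-- The action of `γ ∈ Γ` on `𝔅(V)`. -/
def act (γ : Γ) : M.NicholsAlgebra →ₐ[k] M.NicholsAlgebra :=
  lift M ((mk M).comp (M.tAct γ)) fun t ht =>
    (mk_eq_zero M _).2 (M.isHopfIdeal_nicholsIdeal.act_mem γ t ht)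

@[simp]
theorem act_mk (γ : Γ) (t : TensorAlgebra k V) : act M γ (mk M t) = mk M (M.tAct γ t) :=
  rfl

/-- `Γ` acts on `𝔅(V)` by algebra automorphisms. -/
instance : MulSemiringAction Γ M.NicholsAlgebra where
  smul γ r := act M γ r
  one_smul r := by
    obtain ⟨t, rfl⟩ := mk_surjective M r
    change act M 1 (mk M t) = mk M t
    rw [act_mk, tAct_one]; rfl
  mul_smul γ γ' r := by
    obtain ⟨t, rfl⟩ := mk_surjective M r
    change act M _ (mk M t) = act M _ (act M _ (mk M t))
    rw [act_mk, act_mk, act_mk, tAct_mul]; rfl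
  smul_zero γ := map_zero (act M γ)
  smul_add γ := map_add (act M γ)
  smul_one γ := map_one (act M γ)
  smul_mul γ := map_mul (act M γ)

theorem smul_mk (γ : Γ) (t : TensorAlgebra k V) : γ • mk M t = mk M (M.tAct γ t) :=
  rfl

theorem smul_ι (γ : Γ) (v : V) : γ • ι M v = ι M (M.act γ v) := by
  simp [ι, smul_mk]

instance : SMulCommClass Γ k M.NicholsAlgebra where
  smul_comm γ c r := map_smul (act M γ) c r

theorem map_lTensor_subtype {P W : Type*} [AddCommGroup P] [Module k P] [AddCommGroup W]
    [Module k W] (f : P →ₗ[k] W) (z : P ⊗[k] M.nicholsIdeal.restrictScalars k) :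
    TensorProduct.map f (mk M).toLinearMap
      ((M.nicholsIdeal.restrictScalars k).subtype.lTensor P z) = 0 := by
  rw [LinearMap.lTensor, ← LinearMap.comp_apply, ← TensorProduct.map_comp]
  have : (mk M).toLinearMap ∘ₗ (M.nicholsIdeal.restrictScalars k).subtype = 0 :=
    LinearMap.ext fun t => (mk_eq_zero M _).2 t.2
  rw [this, TensorProduct.map_zero_right, LinearMap.zero_apply]

theorem map_rTensor_subtype {P W : Type*} [AddCommGroup P] [Module k P] [AddCommGroup W]
    [Module k W] (f : P →ₗ[k] W) (z : M.nicholsIdeal.restrictScalars k ⊗[k] P) :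
    TensorProduct.map (mk M).toLinearMap f
      ((M.nicholsIdeal.restrictScalars k).subtype.rTensor P z) = 0 := by
  rw [LinearMap.rTensor, ← LinearMap.comp_apply, ← TensorProduct.map_comp]
  have : (mk M).toLinearMap ∘ₗ (M.nicholsIdeal.restrictScalars k).subtype = 0 :=
    LinearMap.ext fun t => (mk_eq_zero M _).2 t.2
  rw [this, TensorProduct.map_zero_left, LinearMap.zero_apply]

/-- The coaction `δ : 𝔅(V) → kΓ ⊗ 𝔅(V)`. -/
def coact : M.NicholsAlgebra →ₐ[k] MonoidAlgebra k Γ ⊗[k] M.NicholsAlgebra :=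
  lift M ((Algebra.TensorProduct.map (AlgHom.id k _) (mk M)).comp M.tCoact) fun t ht => by
    obtain ⟨z, hz⟩ := M.isHopfIdeal_nicholsIdeal.coact_mem t ht
    rw [AlgHom.comp_apply, ← hz]
    exact map_lTensor_subtype M (AlgHom.id k (MonoidAlgebra k Γ)).toLinearMap z

theorem coact_mk (t : TensorAlgebra k V) :
    coact M (mk M t) = Algebra.TensorProduct.map (AlgHom.id k _) (mk M) (M.tCoact t) :=
  rfl

/-- The comultiplication `Δ : 𝔅(V) → 𝔅(V) ⊗ 𝔅(V)`. -/
def comul : M.NicholsAlgebra →ₗ[k] M.NicholsAlgebra ⊗[k] M.NicholsAlgebra :=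
  liftLinear M (TensorProduct.map (mk M).toLinearMap (mk M).toLinearMap ∘ₗ M.tComul) fun t ht => by
    obtain ⟨x, ⟨x', rfl⟩, y, ⟨y', rfl⟩, hxy⟩ :=
      Submodule.mem_sup.1 (M.isHopfIdeal_nicholsIdeal.comul_mem t ht)
    rw [LinearMap.comp_apply, ← hxy, map_add, map_rTensor_subtype, map_lTensor_subtype, add_zero]

theorem comul_mk (t : TensorAlgebra k V) :
    comul M (mk M t) =
      TensorProduct.map (mk M).toLinearMap (mk M).toLinearMap (M.tComul t) :=
  rfl

/-- The counit `ε : 𝔅(V) → k`, with `ε(v) = 0` for `v ∈ V`. -/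
def counit : M.NicholsAlgebra →ₐ[k] k :=
  lift M TensorAlgebra.algebraMapInv fun t ht => by
    have h := LinearMap.congr_fun M.algebraMapInv_eq_proj t
    have h0 : GradedAlgebra.proj M.tGrading 0 t = 0 :=
      M.isHopfIdeal_nicholsIdeal.proj_eq_zero t ht 0 (by norm_num)
    rw [h0] at h
    exact (TensorAlgebra.algebraMap_eq_zero_iff V _).1 h

theorem counit_ι (v : V) : counit M (ι M v) = 0 := by
  change TensorAlgebra.algebraMapInv (TensorAlgebra.ι k v) = 0
  simp [TensorAlgebra.algebraMapInv]

end NicholsAlgebra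

/-! ### The bosonization -/

/-- The bosonization `𝔅(V) # kΓ`. Its elements are the linear combinations of the elements
`r # γ`, written `SkewMonoidAlgebra.single γ r`, with `r ∈ 𝔅(V)` and `γ ∈ Γ`; the multiplication is
`(r # γ) (s # γ') = r (γ.s) # γ γ'`. -/
abbrev Bosonization (M : YDModule k Γ V) : Type _ :=
  SkewMonoidAlgebra M.NicholsAlgebra Γ

namespace Bosonization

variable (M : YDModule k Γ V)

theorem single_mul_single (γ γ' : Γ) (r s : M.NicholsAlgebra) :
    (SkewMonoidAlgebra.single γ r * SkewMonoidAlgebra.single γ' s : M.Bosonization) =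
      SkewMonoidAlgebra.single (γ * γ') (r * γ • s) :=
  SkewMonoidAlgebra.single_mul_single

/-- The algebra map `𝔅(V) → 𝔅(V) # kΓ`, `r ↦ r # 1`. -/
def ofNichols : M.NicholsAlgebra →ₐ[k] M.Bosonization where
  toFun r := SkewMonoidAlgebra.single 1 r
  map_one' := rfl
  map_mul' r s := by simp
  map_zero' := by simp
  map_add' := by simp [SkewMonoidAlgebra.single_add]
  commutes' c := rfl

theorem ofNichols_apply (r : M.NicholsAlgebra) :
    ofNichols M r = SkewMonoidAlgebra.single 1 r :=
  rfl

/-- The group homomorphism from `Γ` to `𝔅(V) # kΓ`, `γ ↦ 1 # γ`. -/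
def ofGroup : Γ →* M.Bosonization where
  toFun γ := SkewMonoidAlgebra.single γ 1
  map_one' := rfl
  map_mul' γ γ' := by simp

theorem ofGroup_apply (γ : Γ) : ofGroup M γ = SkewMonoidAlgebra.single γ 1 :=
  rfl

theorem ofNichols_mul_ofGroup (r : M.NicholsAlgebra) (γ : Γ) :
    ofNichols M r * ofGroup M γ = SkewMonoidAlgebra.single γ r := by
  simp [ofNichols_apply, ofGroup_apply]

theorem ofGroup_mul_ofNichols (r : M.NicholsAlgebra) (γ : Γ) :
    ofGroup M γ * ofNichols M r = ofNichols M (γ • r) * ofGroup M γ := by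
  simp [ofNichols_apply, ofGroup_apply]

/-- The algebra map `kΓ → 𝔅(V) # kΓ`, `h ↦ 1 # h`. -/
def ofGroupAlgebra : MonoidAlgebra k Γ →ₐ[k] M.Bosonization :=
  MonoidAlgebra.lift k M.Bosonization Γ (ofGroup M)

theorem ofGroupAlgebra_single (γ : Γ) :
    ofGroupAlgebra M (MonoidAlgebra.single γ 1) = ofGroup M γ := by
  simp [ofGroupAlgebra]

/-- The linear map `𝔅(V) ⊗ kΓ → 𝔅(V) # kΓ`, `r ⊗ h ↦ r # h`. -/
def smash : M.NicholsAlgebra ⊗[k] MonoidAlgebra k Γ →ₗ[k] M.Bosonization :=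
  LinearMap.mul' k M.Bosonization ∘ₗ
    TensorProduct.map (ofNichols M).toLinearMap (ofGroupAlgebra M).toLinearMap

theorem smash_tmul_single (r : M.NicholsAlgebra) (γ : Γ) :
    smash M (r ⊗ₜ MonoidAlgebra.single γ 1) = SkewMonoidAlgebra.single γ r := by
  simp [smash, ofGroupAlgebra_single, ofNichols_mul_ofGroup]

/-- For `γ ∈ Γ`, the linear map `𝔅(V) ⊗ 𝔅(V) → (𝔅(V) # kΓ) ⊗ (𝔅(V) # kΓ)`,
`r ⊗ s ↦ (r # s₋₁ γ) ⊗ (s₀ # γ)`. -/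
def comulAux (γ : Γ) :
    M.NicholsAlgebra ⊗[k] M.NicholsAlgebra →ₗ[k] M.Bosonization ⊗[k] M.Bosonization :=
  TensorProduct.map
      (smash M ∘ₗ (LinearMap.mulRight k (MonoidAlgebra.single γ (1 : k))).lTensor
        M.NicholsAlgebra)
      (LinearMap.mulRight k (ofGroup M γ) ∘ₗ (ofNichols M).toLinearMap) ∘ₗ
    (TensorProduct.assoc k M.NicholsAlgebra (MonoidAlgebra k Γ)
      M.NicholsAlgebra).symm.toLinearMap ∘ₗ
    (NicholsAlgebra.coact M).toLinearMap.lTensor M.NicholsAlgebra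

/-- The comultiplication of the bosonization:
`Δ(r # γ) = (r₁ # (r₂)₋₁ γ) ⊗ ((r₂)₀ # γ)` for `γ ∈ Γ`. -/
def comulLinear : M.Bosonization →ₗ[k] M.Bosonization ⊗[k] M.Bosonization :=
  Finsupp.lsum k (fun γ => comulAux M γ ∘ₗ NicholsAlgebra.comul M) ∘ₗ
    (SkewMonoidAlgebra.coeffLinearEquiv (S := k)).toLinearMap

theorem comulLinear_single (γ : Γ) (r : M.NicholsAlgebra) :
    comulLinear M (SkewMonoidAlgebra.single γ r) = comulAux M γ (NicholsAlgebra.comul M r) := by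
  have : SkewMonoidAlgebra.coeffLinearEquiv (S := k) (SkewMonoidAlgebra.single γ r) =
      Finsupp.single γ r := rfl
  rw [comulLinear, LinearMap.comp_apply, LinearEquiv.coe_coe, this]
  simp

/-- The counit of the bosonization: `ε(r # γ) = ε(r)`. -/
def counitHom : M.Bosonization →ₐ[k] k :=
  SkewMonoidAlgebra.liftNCAlgHom (NicholsAlgebra.counit M) 1 fun {r γ} => by
    have : (NicholsAlgebra.counit M).comp (NicholsAlgebra.act M γ) = NicholsAlgebra.counit M := by
      refine NicholsAlgebra.algHom_ext fun v => ?_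
      have h : NicholsAlgebra.act M γ (NicholsAlgebra.ι M v) = NicholsAlgebra.ι M (M.act γ v) :=
        NicholsAlgebra.smul_ι M γ v
      rw [AlgHom.comp_apply, h, NicholsAlgebra.counit_ι, NicholsAlgebra.counit_ι]
    have h : NicholsAlgebra.counit M (γ • r) = NicholsAlgebra.counit M r :=
      DFunLike.congr_fun this r
    simpa using h

theorem counitHom_single (γ : Γ) (r : M.NicholsAlgebra) :
    counitHom M (SkewMonoidAlgebra.single γ r) = NicholsAlgebra.counit M r := by
  simp [counitHom, SkewMonoidAlgebra.liftNCAlgHom, SkewMonoidAlgebra.liftNCRingHom]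

/-- The algebra map `kΓ ⊗ 𝔅(V) → (𝔅(V) # kΓ) ⊗ (𝔅(V) # kΓ)`, `h ⊗ s ↦ (1 # h) ⊗ (s # 1)`. -/
def incl : MonoidAlgebra k Γ ⊗[k] M.NicholsAlgebra →ₐ[k] M.Bosonization ⊗[k] M.Bosonization :=
  Algebra.TensorProduct.map (ofGroupAlgebra M) (ofNichols M)

theorem comulAux_tmul (γ : Γ) (a b : M.NicholsAlgebra) :
    comulAux M γ (a ⊗ₜ b) =
      (ofNichols M a ⊗ₜ 1) * incl M (NicholsAlgebra.coact M b) *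
        (ofGroup M γ ⊗ₜ ofGroup M γ) := by
  simp only [comulAux, LinearMap.comp_apply, LinearMap.lTensor_tmul, AlgHom.toLinearMap_apply]
  generalize NicholsAlgebra.coact M b = z
  induction z using TensorProduct.induction_on with
  | zero => simp
  | add x y hx hy => rw [TensorProduct.tmul_add, map_add, map_add, hx, hy, map_add, mul_add, add_mul]
  | tmul h s =>
    simp [smash, incl, ofGroupAlgebra_single, mul_assoc]

theorem comulAux_eq (γ : Γ) (X : M.NicholsAlgebra ⊗[k] M.NicholsAlgebra) :
    comulAux M γ X = comulAux M 1 X * (ofGroup M γ ⊗ₜ ofGroup M γ) := by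
  induction X using TensorProduct.induction_on with
  | zero => simp
  | add x y hx hy => rw [map_add, hx, hy, map_add, add_mul]
  | tmul a b =>
    rw [comulAux_tmul, comulAux_tmul, map_one, ← Algebra.TensorProduct.one_def, mul_one]

theorem comulAux_one :
    comulAux M 1 (TensorProduct.map (NicholsAlgebra.mk M).toLinearMap
      (NicholsAlgebra.mk M).toLinearMap (1 ⊗ₜ 1)) = 1 := by
  rw [TensorProduct.map_tmul]
  simp only [AlgHom.toLinearMap_apply]
  rw [map_one, comulAux_tmul]
  simp only [map_one, ← Algebra.TensorProduct.one_def, mul_one]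

theorem coact_ι_mul {g : Γ} {v : V} (hv : M.coact v = MonoidAlgebra.single g 1 ⊗ₜ v)
    (b : M.NicholsAlgebra) :
    NicholsAlgebra.coact M (NicholsAlgebra.ι M v * b) =
      (MonoidAlgebra.single g 1 ⊗ₜ NicholsAlgebra.ι M v) * NicholsAlgebra.coact M b := by
  rw [map_mul]
  congr 1
  change NicholsAlgebra.coact M (NicholsAlgebra.mk M (TensorAlgebra.ι k v)) = _
  rw [NicholsAlgebra.coact_mk, tCoact_ι, hv]
  simp [NicholsAlgebra.ι]

theorem comulAux_braidedMul {g : Γ} {v : V} (hv : M.coact v = MonoidAlgebra.single g 1 ⊗ₜ v)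
    (X : TensorAlgebra k V ⊗[k] TensorAlgebra k V) :
    comulAux M 1 (TensorProduct.map (NicholsAlgebra.mk M).toLinearMap
        (NicholsAlgebra.mk M).toLinearMap
          (M.braidedMul (TensorAlgebra.ι k v ⊗ₜ 1 + 1 ⊗ₜ TensorAlgebra.ι k v) X)) =
      (ofNichols M (NicholsAlgebra.ι M v) ⊗ₜ 1 +
          ofGroup M g ⊗ₜ ofNichols M (NicholsAlgebra.ι M v)) *
        comulAux M 1 (TensorProduct.map (NicholsAlgebra.mk M).toLinearMap
          (NicholsAlgebra.mk M).toLinearMap X) := by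
  induction X using TensorProduct.induction_on with
  | zero => simp
  | add x y hx hy =>
    rw [map_add (M.braidedMul _), map_add, map_add, hx, hy, map_add, map_add, mul_add]
  | tmul a b =>
    have h1 : ∀ t, NicholsAlgebra.mk M (TensorAlgebra.ι k v * t) =
        NicholsAlgebra.ι M v * NicholsAlgebra.mk M t := fun t => map_mul _ _ _
    rw [braidedMul_ι M hv, map_add, TensorProduct.map_tmul, TensorProduct.map_tmul,
      TensorProduct.map_tmul, map_add]
    simp only [AlgHom.toLinearMap_apply]
    rw [h1, h1, comulAux_tmul, comulAux_tmul, comulAux_tmul, coact_ι_mul M hv, ← NicholsAlgebra.smul_mk, map_mul (incl M)]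
    have h2 : incl M (MonoidAlgebra.single g 1 ⊗ₜ NicholsAlgebra.ι M v) =
        ofGroup M g ⊗ₜ ofNichols M (NicholsAlgebra.ι M v) := by
      simp [incl, ofGroupAlgebra_single]
    rw [h2, add_mul, map_mul, map_one, ← Algebra.TensorProduct.one_def, mul_one, mul_one, mul_one]
    congr 1
    · rw [← mul_assoc, Algebra.TensorProduct.tmul_mul_tmul, one_mul]
    · rw [← mul_assoc, ← mul_assoc, Algebra.TensorProduct.tmul_mul_tmul,
        Algebra.TensorProduct.tmul_mul_tmul, ofGroup_mul_ofNichols, one_mul, mul_one]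

/-- The algebra map on `T(V)` that induces the comultiplication of the bosonization. -/
def comulT : TensorAlgebra k V →ₐ[k] M.Bosonization ⊗[k] M.Bosonization :=
  TensorAlgebra.lift k
    (comulLinear M ∘ₗ (ofNichols M).toLinearMap ∘ₗ NicholsAlgebra.ι M)

theorem comulLinear_ofNichols_mk (t : TensorAlgebra k V) :
    comulLinear M (ofNichols M (NicholsAlgebra.mk M t)) =
      comulAux M 1 (TensorProduct.map (NicholsAlgebra.mk M).toLinearMap
        (NicholsAlgebra.mk M).toLinearMap (M.tComul t)) := by
  rw [ofNichols_apply, comulLinear_single, NicholsAlgebra.comul_mk]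

theorem comulLinear_one : comulLinear M 1 = 1 := by
  have h := comulLinear_ofNichols_mk M 1
  rw [map_one, map_one, tComul_one] at h
  rw [h, comulAux_one]

theorem comulLinear_ι {g : Γ} {v : V} (hv : M.coact v = MonoidAlgebra.single g 1 ⊗ₜ v) :
    comulLinear M (ofNichols M (NicholsAlgebra.ι M v)) =
      ofNichols M (NicholsAlgebra.ι M v) ⊗ₜ 1 +
        ofGroup M g ⊗ₜ ofNichols M (NicholsAlgebra.ι M v) := by
  have h := comulAux_braidedMul M hv (1 ⊗ₜ 1)
  have h2 := tComul_ι_mul M v 1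
  rw [tComul_one, mul_one] at h2
  rw [← h2, ← comulLinear_ofNichols_mk] at h
  exact h.trans (by rw [comulAux_one, mul_one])

theorem comulT_eq (t : TensorAlgebra k V) :
    comulT M t = comulLinear M (ofNichols M (NicholsAlgebra.mk M t)) := by
  have : (comulT M).toLinearMap =
      comulLinear M ∘ₗ (ofNichols M).toLinearMap ∘ₗ (NicholsAlgebra.mk M).toLinearMap := by
    refine tensor_hom_ext ?_ fun v t ht => ?_
    · simp [comulLinear_one]
    · have key : LinearMap.mulRight k (comulT M t) ∘ₗ (comulT M).toLinearMap ∘ₗ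
          TensorAlgebra.ι k = comulLinear M ∘ₗ (ofNichols M).toLinearMap ∘ₗ
            (NicholsAlgebra.mk M).toLinearMap ∘ₗ LinearMap.mulRight k t ∘ₗ
              TensorAlgebra.ι k := by
        refine M.hom_ext_homogeneous fun g v hv => ?_
        simp only [LinearMap.comp_apply, AlgHom.toLinearMap_apply, LinearMap.mulRight_apply] at ht ⊢
        rw [comulLinear_ofNichols_mk, tComul_ι_mul, comulAux_braidedMul M hv,
          ← comulLinear_ofNichols_mk, ← ht, comulT, TensorAlgebra.lift_ι_apply]
        simp only [LinearMap.comp_apply, AlgHom.toLinearMap_apply]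
        rw [comulLinear_ι M hv]
      simpa using LinearMap.congr_fun key v
  exact LinearMap.congr_fun this t

theorem comulLinear_ofNichols_mul (r s : M.NicholsAlgebra) :
    comulLinear M (ofNichols M (r * s)) =
      comulLinear M (ofNichols M r) * comulLinear M (ofNichols M s) := by
  obtain ⟨r, rfl⟩ := NicholsAlgebra.mk_surjective M r
  obtain ⟨s, rfl⟩ := NicholsAlgebra.mk_surjective M s
  rw [← map_mul, ← comulT_eq, ← comulT_eq, ← comulT_eq, map_mul]

/-- The restriction of the comultiplication to `𝔅(V)`, as an algebra map. -/
def comulN : M.NicholsAlgebra →ₐ[k] M.Bosonization ⊗[k] M.Bosonization :=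
  AlgHom.ofLinearMap (comulLinear M ∘ₗ (ofNichols M).toLinearMap)
    (by simp [comulLinear_one]) (comulLinear_ofNichols_mul M)

theorem comulN_ι {g : Γ} {v : V} (hv : M.coact v = MonoidAlgebra.single g 1 ⊗ₜ v) :
    comulN M (NicholsAlgebra.ι M v) =
      ofNichols M (NicholsAlgebra.ι M v) ⊗ₜ 1 +
        ofGroup M g ⊗ₜ ofNichols M (NicholsAlgebra.ι M v) :=
  comulLinear_ι M hv

theorem algHom_ext_homogeneous {B : Type*} [Ring B] [Algebra k B]
    {f f' : M.NicholsAlgebra →ₐ[k] B}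
    (h : ∀ (g : Γ) (v : V), M.coact v = MonoidAlgebra.single g 1 ⊗ₜ v →
      f (NicholsAlgebra.ι M v) = f' (NicholsAlgebra.ι M v)) : f = f' := by
  have : f.toLinearMap ∘ₗ NicholsAlgebra.ι M = f'.toLinearMap ∘ₗ NicholsAlgebra.ι M :=
    M.hom_ext_homogeneous h
  exact NicholsAlgebra.algHom_ext fun v => LinearMap.congr_fun this v

theorem coact_act_homogeneous {g : Γ} {v : V} (γ : Γ)
    (hv : M.coact v = MonoidAlgebra.single g 1 ⊗ₜ v) :
    M.coact (M.act γ v) = MonoidAlgebra.single g 1 ⊗ₜ M.act γ v := by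
  rw [coact_act, hv, LinearMap.lTensor_tmul]

theorem comulN_smul (γ : Γ) (r : M.NicholsAlgebra) :
    comulN M (γ • r) * (ofGroup M γ ⊗ₜ ofGroup M γ) =
      (ofGroup M γ ⊗ₜ ofGroup M γ) * comulN M r := by
  have hV : LinearMap.mulRight k (ofGroup M γ ⊗ₜ[k] ofGroup M γ) ∘ₗ (comulN M).toLinearMap ∘ₗ
      NicholsAlgebra.ι M ∘ₗ M.act γ =
      LinearMap.mulLeft k (ofGroup M γ ⊗ₜ[k] ofGroup M γ) ∘ₗ (comulN M).toLinearMap ∘ₗ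
        NicholsAlgebra.ι M := by
    refine M.hom_ext_homogeneous fun g v hv => ?_
    simp only [LinearMap.comp_apply, AlgHom.toLinearMap_apply, LinearMap.mulRight_apply,
      LinearMap.mulLeft_apply]
    rw [comulN_ι M hv, comulN_ι M (coact_act_homogeneous M γ hv), add_mul, mul_add,
      Algebra.TensorProduct.tmul_mul_tmul, Algebra.TensorProduct.tmul_mul_tmul,
      Algebra.TensorProduct.tmul_mul_tmul, Algebra.TensorProduct.tmul_mul_tmul,
      ofGroup_mul_ofNichols, NicholsAlgebra.smul_ι, one_mul, mul_one, ← map_mul, ← map_mul,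
      mul_comm g γ]
  obtain ⟨t, rfl⟩ := NicholsAlgebra.mk_surjective M r
  have : LinearMap.mulRight k (ofGroup M γ ⊗ₜ[k] ofGroup M γ) ∘ₗ (comulN M).toLinearMap ∘ₗ
      (NicholsAlgebra.act M γ).toLinearMap ∘ₗ (NicholsAlgebra.mk M).toLinearMap =
      LinearMap.mulLeft k (ofGroup M γ ⊗ₜ[k] ofGroup M γ) ∘ₗ (comulN M).toLinearMap ∘ₗ
        (NicholsAlgebra.mk M).toLinearMap := by
    refine tensor_hom_ext ?_ fun v t ht => ?_
    · simp
    · have h := LinearMap.congr_fun hV v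
      have h1 : NicholsAlgebra.act M γ (NicholsAlgebra.mk M (TensorAlgebra.ι k v)) =
          NicholsAlgebra.ι M (M.act γ v) := NicholsAlgebra.smul_ι M γ v
      have h2 : NicholsAlgebra.mk M (TensorAlgebra.ι k v) = NicholsAlgebra.ι M v := rfl
      simp only [LinearMap.comp_apply, AlgHom.toLinearMap_apply, LinearMap.mulRight_apply,
        LinearMap.mulLeft_apply] at h ht ⊢
      rw [map_mul, map_mul, map_mul, map_mul, mul_assoc, ht, ← mul_assoc, h1, h, h2, mul_assoc]
  exact LinearMap.congr_fun this t

theorem comulLinear_single' (γ : Γ) (r : M.NicholsAlgebra) :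
    comulLinear M (SkewMonoidAlgebra.single γ r) =
      comulN M r * (ofGroup M γ ⊗ₜ ofGroup M γ) := by
  rw [comulLinear_single, comulAux_eq, ← comulLinear_single]
  rfl

theorem comulLinear_mul (a b : M.Bosonization) :
    comulLinear M (a * b) = comulLinear M a * comulLinear M b := by
  induction a using SkewMonoidAlgebra.induction_on with
  | zero => simp
  | add x y hx hy => rw [add_mul, map_add, hx, hy, map_add, add_mul]
  | single γ r =>
    induction b using SkewMonoidAlgebra.induction_on with
    | zero => simp
    | add x y hx hy => rw [mul_add, map_add, hx, hy, map_add, mul_add]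
    | single γ' s =>
      rw [single_mul_single, comulLinear_single', comulLinear_single', comulLinear_single',
        map_mul, map_mul, ← Algebra.TensorProduct.tmul_mul_tmul, mul_assoc, ← mul_assoc _ _ (_ ⊗ₜ _),
        comulN_smul]
      simp only [mul_assoc]

/-- The comultiplication of the bosonization as an algebra map. -/
def comulHom : M.Bosonization →ₐ[k] M.Bosonization ⊗[k] M.Bosonization :=
  AlgHom.ofLinearMap (comulLinear M) (comulLinear_one M) (comulLinear_mul M)

theorem comulHom_ofGroup (γ : Γ) : comulHom M (ofGroup M γ) = ofGroup M γ ⊗ₜ ofGroup M γ := by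
  have := comulLinear_single' M γ 1
  rw [map_one, one_mul] at this
  exact this

theorem comulHom_ι {g : Γ} {v : V} (hv : M.coact v = MonoidAlgebra.single g 1 ⊗ₜ v) :
    comulHom M (ofNichols M (NicholsAlgebra.ι M v)) =
      ofNichols M (NicholsAlgebra.ι M v) ⊗ₜ 1 +
        ofGroup M g ⊗ₜ ofNichols M (NicholsAlgebra.ι M v) :=
  comulLinear_ι M hv

/-- Algebra maps on the bosonization that agree on `Γ` and on homogeneous vectors are equal. -/
theorem hom_ext {B : Type*} [Ring B] [Algebra k B] {f f' : M.Bosonization →ₐ[k] B}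
    (hΓ : ∀ γ, f (ofGroup M γ) = f' (ofGroup M γ))
    (hV : ∀ (g : Γ) (v : V), M.coact v = MonoidAlgebra.single g 1 ⊗ₜ v →
      f (ofNichols M (NicholsAlgebra.ι M v)) = f' (ofNichols M (NicholsAlgebra.ι M v))) :
    f = f' := by
  have h := algHom_ext_homogeneous M (f := f.comp (ofNichols M)) (f' := f'.comp (ofNichols M)) hV
  ext a
  induction a using SkewMonoidAlgebra.induction_on with
  | zero => simp
  | add x y hx hy => rw [map_add, map_add, hx, hy]
  | single γ r =>
    rw [← ofNichols_mul_ofGroup, map_mul, map_mul, hΓ]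
    congr 1
    exact DFunLike.congr_fun h r

theorem counitHom_ofGroup (γ : Γ) : counitHom M (ofGroup M γ) = 1 := by
  rw [ofGroup_apply, counitHom_single, map_one]

theorem counitHom_ι (v : V) : counitHom M (ofNichols M (NicholsAlgebra.ι M v)) = 0 := by
  rw [ofNichols_apply, counitHom_single, NicholsAlgebra.counit_ι]

/-- The bialgebra structure of the bosonization, with the comultiplication `comulLinear` and the
counit `counitHom` (see `comul_single` and `counit_single`). It has an antipode; bialgebra
automorphisms of a Hopf algebra automatically commute with the antipode, so that the Hopf algebra
automorphisms of the bosonization are its bialgebra automorphisms. -/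
instance : Bialgebra k M.Bosonization :=
  Bialgebra.ofAlgHom (comulHom M) (counitHom M)
    (hom_ext M (fun γ => by simp [comulHom_ofGroup])
      (fun g v hv => by
        simp [comulHom_ι M hv, comulHom_ofGroup, TensorProduct.add_tmul, TensorProduct.tmul_add,
          Algebra.TensorProduct.one_def, add_assoc]))
    (hom_ext M (fun γ => by simp [comulHom_ofGroup, counitHom_ofGroup])
      (fun g v hv => by simp [comulHom_ι M hv, counitHom_ofGroup, counitHom_ι]))
    (hom_ext M (fun γ => by simp [comulHom_ofGroup, counitHom_ofGroup])
      (fun g v hv => by simp [comulHom_ι M hv, counitHom_ofGroup, counitHom_ι]))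

theorem comul_single (γ : Γ) (r : M.NicholsAlgebra) :
    Coalgebra.comul (R := k) (SkewMonoidAlgebra.single γ r : M.Bosonization) =
      comulAux M γ (NicholsAlgebra.comul M r) :=
  comulLinear_single M γ r

theorem counit_single (γ : Γ) (r : M.NicholsAlgebra) :
    Coalgebra.counit (R := k) (SkewMonoidAlgebra.single γ r : M.Bosonization) =
      NicholsAlgebra.counit M r :=
  counitHom_single M γ r

end Bosonization

end

end YDModule

/-!
The group-like elements of `𝔅(V) # kΓ` are those of `Γ`: in a grading of a coalgebra by degree the
top component of `y ⊗ y` lies in twice the top degree of `y`, so a group-like element has degree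
`0`. Let `y` be a `(g, 1)`-skew primitive element on which `Γ` acts through `χ ≠ 1`. It is killed
by the projection to `kΓ`, hence lies in `𝔅(V)`, and its homogeneous components are again skew
primitive. A component of degree at least `2` generates a Hopf ideal of `𝔅(V) # kΓ` that meets
`𝔅(V)` in the image of a Hopf ideal of `T(V)` in degrees at least `2`, which is zero by the
maximality of the ideal defining `𝔅(V)`. So `y` lies in `V`.

It follows that an automorphism of `𝔅(V) # kΓ` restricts to an automorphism `ψ` of `Γ` and, since
`V` is spanned by such elements `y`, to a linear automorphism of `V` that is compatible with the
action and the coaction up to `ψ`. Conversely a linear automorphism of the latter kind extends to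
`T(V)`, preserves the largest Hopf ideal, and extends to the bosonization. When the pairs
`(g i, χ i)` are distinct, the components `V_g^χ` are at most one-dimensional, and these linear
automorphisms permute the basis up to scalars.
-/

namespace YDModule

noncomputable section

open Polynomial

variable {k Γ V : Type*} [Field k] [CommGroup Γ] [AddCommGroup V] [Module k V]

/-! ### The grading of the tensor algebra as a coaction of `k[X]` -/

theorem tensor_hom_ext_homogeneous (M : YDModule k Γ V) {W : Type*} [AddCommGroup W] [Module k W]
    {f f' : TensorAlgebra k V →ₗ[k] W} (h1 : f 1 = f' 1)
    (hι : ∀ (g : Γ) (v : V) (t), M.coact v = MonoidAlgebra.single g 1 ⊗ₜ[k] v → f t = f' t →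
      f (TensorAlgebra.ι k v * t) = f' (TensorAlgebra.ι k v * t)) : f = f' := by
  refine tensor_hom_ext h1 fun v t ht => ?_
  have h : f ∘ₗ LinearMap.mulRight k t ∘ₗ TensorAlgebra.ι k =
      f' ∘ₗ LinearMap.mulRight k t ∘ₗ TensorAlgebra.ι k :=
    M.hom_ext_homogeneous fun g v hv => hι g v t hv ht
  exact LinearMap.congr_fun h v

/-- The grading of `T(V)`, encoded as the algebra map `T(V) → T(V)[X]`, `v ↦ v X`; the component
of degree `n` of `t` is the coefficient of `X ^ n` in `tGr t`. -/
def tGr : TensorAlgebra k V →ₐ[k] (TensorAlgebra k V)[X] :=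
  TensorAlgebra.lift k ((monomial 1).restrictScalars k ∘ₗ TensorAlgebra.ι k)

@[simp]
theorem tGr_ι (v : V) : tGr (TensorAlgebra.ι k v) = monomial 1 (TensorAlgebra.ι k v) := by
  simp [tGr]

theorem tGr_of_mem (M : YDModule k Γ V) {n : ℕ} {t : TensorAlgebra k V} (ht : t ∈ M.tGrading n) :
    tGr t = monomial n t := by
  induction ht using Submodule.pow_induction_on_left' with
  | algebraMap r => simp [monomial_zero_left]
  | add x y i _ _ ihx ihy => simp [ihx, ihy]
  | mem_mul m hm i x _ ih =>
    obtain ⟨v, rfl⟩ := hm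
    simp [ih, monomial_mul_monomial, add_comm]

theorem coeff_tGr (M : YDModule k Γ V) (n : ℕ) (t : TensorAlgebra k V) :
    (tGr t).coeff n = GradedRing.proj M.tGrading n t := by
  induction t using DirectSum.Decomposition.inductionOn M.tGrading with
  | zero => simp
  | add s t hs ht => simp [hs, ht]
  | @homogeneous i t =>
    rw [tGr_of_mem M t.2, coeff_monomial, GradedRing.proj_apply, DirectSum.decompose_coe,
      DirectSum.coe_of_apply]
    split_ifs <;> rfl

/-! ### The Nichols algebra -/

namespace NicholsAlgebra

variable (M : YDModule k Γ V)

/-- The grading of `𝔅(V)`, encoded as the algebra map `𝔅(V) → 𝔅(V)[X]`, `v ↦ v X`. -/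
def gr : M.NicholsAlgebra →ₐ[k] M.NicholsAlgebra[X] :=
  lift M ((mapAlgHom (mk M)).comp tGr) fun t ht => by
    ext n
    have h : mk M (GradedRing.proj M.tGrading n t) = 0 :=
      (mk_eq_zero M _).2 (M.isHopfIdeal_nicholsIdeal.isHomogeneous n ht)
    simpa [coeff_tGr M] using h

theorem coeff_gr_mk (t : TensorAlgebra k V) (n : ℕ) :
    (gr M (mk M t)).coeff n = mk M (GradedRing.proj M.tGrading n t) := by
  simp [gr, ← coeff_tGr M]

@[simp]
theorem gr_ι (v : V) : gr M (ι M v) = monomial 1 (ι M v) := by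
  simp [gr, ι]

theorem gr_coeff_gr (r : M.NicholsAlgebra) (n : ℕ) :
    gr M ((gr M r).coeff n) = monomial n ((gr M r).coeff n) := by
  obtain ⟨t, rfl⟩ := mk_surjective M r
  have h : GradedRing.proj M.tGrading n t ∈ M.tGrading n := SetLike.coe_mem _
  rw [coeff_gr_mk, gr, lift_mk, AlgHom.comp_apply, tGr_of_mem M h, coe_mapAlgHom, map_monomial]
  rfl

theorem coeff_one_gr_mem_range_ι (r : M.NicholsAlgebra) :
    (gr M r).coeff 1 ∈ LinearMap.range (ι M) := by
  obtain ⟨t, rfl⟩ := mk_surjective M r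
  have h : GradedRing.proj M.tGrading 1 t ∈ M.tGrading 1 := SetLike.coe_mem _
  rw [tGrading, pow_one] at h
  obtain ⟨v, hv⟩ := h
  exact ⟨v, by rw [coeff_gr_mk, ← hv]; rfl⟩

theorem ι_injective : Function.Injective (ι M) := by
  refine (injective_iff_map_eq_zero _).2 fun v hv => ?_
  have h := M.isHopfIdeal_nicholsIdeal.proj_eq_zero _ ((mk_eq_zero M _).1 hv) 1 one_lt_two
  rwa [← coeff_tGr, tGr_ι, coeff_monomial_same, TensorAlgebra.ι_eq_zero_iff] at h

theorem coact_ι (v : V) :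
    coact M (ι M v) = (ι M).lTensor (MonoidAlgebra k Γ) (M.coact v) := by
  rw [ι, LinearMap.comp_apply, AlgHom.toLinearMap_apply, coact_mk, tCoact_ι,
    LinearMap.lTensor_comp]
  rfl

theorem counit_coact (r : M.NicholsAlgebra) :
    Algebra.TensorProduct.lid k _
      (Algebra.TensorProduct.map (Bialgebra.counitAlgHom k _) (AlgHom.id k _) (coact M r)) = r := by
  have h : (Algebra.TensorProduct.lid k _).toAlgHom.comp
      ((Algebra.TensorProduct.map (Bialgebra.counitAlgHom k _) (AlgHom.id k _)).comp (coact M)) =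
      AlgHom.id k _ :=
    Bosonization.algHom_ext_homogeneous M fun g v hv => by simp [coact_ι, hv]
  exact DFunLike.congr_fun h r

end NicholsAlgebra

/-! ### Kernels that are Hopf ideals -/

theorem ker_tensorProduct_map {E E' F F' : Type*} [AddCommGroup E] [AddCommGroup E']
    [AddCommGroup F] [AddCommGroup F'] [Module k E] [Module k E'] [Module k F] [Module k F']
    (f : E →ₗ[k] F) (f' : E' →ₗ[k] F') :
    LinearMap.ker (TensorProduct.map f f') =
      LinearMap.range ((LinearMap.ker f).subtype.rTensor E') ⊔
        LinearMap.range ((LinearMap.ker f').subtype.lTensor E) := by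
  have h : TensorProduct.map f f' =
      TensorProduct.map (LinearMap.range f).subtype (LinearMap.range f').subtype ∘ₗ
        TensorProduct.map f.rangeRestrict f'.rangeRestrict := by
    rw [← TensorProduct.map_comp]
    rfl
  rw [sup_comm, h, LinearMap.ker_comp_of_ker_eq_bot _ (LinearMap.ker_eq_bot.2
    (TensorProduct.map_injective_of_flat_flat _ _ (Submodule.subtype_injective _)
      (Submodule.subtype_injective _)))]
  refine TensorProduct.map_ker (fun x => ?_) f.surjective_rangeRestrict (fun x => ?_)
    f'.surjective_rangeRestrict <;>
  simp [← LinearMap.mem_ker]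

section Kernels

variable {B : Type*} [Ring B] [Algebra k B]

theorem isHopfIdeal_ker (M : YDModule k Γ V) {q : TensorAlgebra k V →ₐ[k] B}
    (h_gr : ∀ t, q t = 0 → mapAlgHom q (tGr t) = 0)
    (h_lt : ∀ t, q t = 0 → ∀ n < 2, (tGr t).coeff n = 0)
    (h_act : ∀ γ t, q t = 0 → q (M.tAct γ t) = 0)
    (h_coact : ∀ t, q t = 0 → Algebra.TensorProduct.map (AlgHom.id k _) q (M.tCoact t) = 0)
    (h_comul : ∀ t, q t = 0 →
      TensorProduct.map q.toLinearMap q.toLinearMap (M.tComul t) = 0) :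
    M.IsHopfIdeal (RingHom.ker q) where
  isTwoSided := inferInstance
  isHomogeneous n t ht := by
    have h := congrArg (coeff · n) (h_gr t ht)
    simpa [coeff_tGr M] using h
  proj_eq_zero t ht n hn := by rw [← coeff_tGr, h_lt t ht n hn]
  act_mem := h_act
  coact_mem t ht := (Module.Flat.lTensor_exact (MonoidAlgebra k Γ)
    (LinearMap.exact_subtype_ker_map q.toLinearMap) _).1 (h_coact t ht)
  comul_mem t ht := (ker_tensorProduct_map q.toLinearMap q.toLinearMap).le (h_comul t ht)

theorem NicholsAlgebra.injective_of_hopf_ker (M : YDModule k Γ V) {f : M.NicholsAlgebra →ₐ[k] B}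
    (h_gr : ∀ r, f r = 0 → mapAlgHom f (gr M r) = 0)
    (h_lt : ∀ r, f r = 0 → ∀ n < 2, (gr M r).coeff n = 0)
    (h_act : ∀ (γ : Γ) r, f r = 0 → f (γ • r) = 0)
    (h_coact : ∀ r, f r = 0 → Algebra.TensorProduct.map (AlgHom.id k _) f (coact M r) = 0)
    (h_comul : ∀ r, f r = 0 →
      TensorProduct.map f.toLinearMap f.toLinearMap (comul M r) = 0) :
    Function.Injective f := by
  have h : M.IsHopfIdeal (RingHom.ker (f.comp (mk M))) := by
    refine M.isHopfIdeal_ker (fun t ht => ?_) (fun t ht n hn => ?_)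
      (fun γ t ht => h_act γ _ ht) (fun t ht => ?_) (fun t ht => ?_)
    · rw [← mapAlgHom_comp]
      exact h_gr (mk M t) ht
    · have h0 := h_lt (mk M t) ht n hn
      rw [coeff_gr_mk, mk_eq_zero] at h0
      have h1 : GradedRing.proj M.tGrading n t ∈ M.tGrading n := SetLike.coe_mem _
      have h2 := M.isHopfIdeal_nicholsIdeal.proj_eq_zero _ h0 n hn
      rwa [← coeff_tGr, tGr_of_mem M h1, coeff_monomial_same, ← coeff_tGr] at h2
    · rw [Algebra.TensorProduct.map_id_comp]
      exact h_coact (mk M t) ht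
    · rw [AlgHom.comp_toLinearMap, TensorProduct.map_comp]
      exact h_comul (mk M t) ht
  refine (injective_iff_map_eq_zero f).2 fun r hr => ?_
  obtain ⟨t, rfl⟩ := mk_surjective M r
  exact (mk_eq_zero M t).2 (h.le hr)

end Kernels

/-! ### The grading of the bosonization and its projection onto the group algebra -/

namespace Bosonization

variable (M : YDModule k Γ V)

section Lift

variable {M} {B : Type*} [Ring B] [Algebra k B] (f : M.NicholsAlgebra →ₐ[k] B) (F : Γ →* B)
  (h : ∀ γ v, f (NicholsAlgebra.ι M (M.act γ v)) * F γ = F γ * f (NicholsAlgebra.ι M v))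

include h in
theorem smul_comm_of_ι (γ : Γ) (r : M.NicholsAlgebra) : f (γ • r) * F γ = F γ * f r := by
  obtain ⟨t, rfl⟩ := NicholsAlgebra.mk_surjective M r
  refine LinearMap.congr_fun (f := LinearMap.mulRight k (F γ) ∘ₗ f.toLinearMap ∘ₗ
    (NicholsAlgebra.act M γ).toLinearMap ∘ₗ (NicholsAlgebra.mk M).toLinearMap)
    (g := LinearMap.mulLeft k (F γ) ∘ₗ f.toLinearMap ∘ₗ (NicholsAlgebra.mk M).toLinearMap)
    (tensor_hom_ext (by simp) fun v t ht => ?_) t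
  have hv : f (NicholsAlgebra.mk M (M.tAct γ (TensorAlgebra.ι k v))) * F γ =
      F γ * f (NicholsAlgebra.mk M (TensorAlgebra.ι k v)) := by
    rw [tAct_ι]
    exact h γ v
  simp only [LinearMap.comp_apply, AlgHom.toLinearMap_apply, LinearMap.mulRight_apply,
    LinearMap.mulLeft_apply, NicholsAlgebra.act_mk, map_mul] at ht ⊢
  rw [mul_assoc, ht, ← mul_assoc, hv, mul_assoc]

/-- The algebra map on `𝔅(V) # kΓ` with prescribed restrictions to `𝔅(V)` and to `Γ`. -/
def lift : M.Bosonization →ₐ[k] B :=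
  SkewMonoidAlgebra.liftNCAlgHom f F fun {r γ} => smul_comm_of_ι f F h γ r

@[simp]
theorem lift_ofNichols (r : M.NicholsAlgebra) : lift f F h (ofNichols M r) = f r := by
  simp [lift, ofNichols_apply, SkewMonoidAlgebra.liftNCAlgHom, SkewMonoidAlgebra.liftNCRingHom]

@[simp]
theorem lift_ofGroup (γ : Γ) : lift f F h (ofGroup M γ) = F γ := by
  simp [lift, ofGroup_apply, SkewMonoidAlgebra.liftNCAlgHom, SkewMonoidAlgebra.liftNCRingHom]

end Lift

/-- The grading of `𝔅(V) # kΓ` in which `Γ` has degree `0` and `V` has degree `1`, encoded as an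
algebra map to polynomials. -/
def gr : M.Bosonization →ₐ[k] M.Bosonization[X] :=
  lift ((mapAlgHom (ofNichols M)).comp (NicholsAlgebra.gr M))
    ((C : _ →+* M.Bosonization[X]).toMonoidHom.comp (ofGroup M)) fun γ v => by
      simp [monomial_mul_C, C_mul_monomial, ofGroup_mul_ofNichols, ofNichols_mul_ofGroup,
        NicholsAlgebra.smul_ι]

/-- The projection `ε # id : 𝔅(V) # kΓ → kΓ`. -/
def toGroupAlgebra : M.Bosonization →ₐ[k] MonoidAlgebra k Γ :=
  lift ((Algebra.ofId k _).comp (NicholsAlgebra.counit M)) (MonoidAlgebra.of k Γ) fun γ v => by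
    simp [NicholsAlgebra.counit_ι]

theorem gr_ofNichols (r : M.NicholsAlgebra) :
    gr M (ofNichols M r) = mapAlgHom (ofNichols M) (NicholsAlgebra.gr M r) := by
  simp [gr]

@[simp]
theorem gr_ι (v : V) : gr M (ofNichols M (NicholsAlgebra.ι M v)) =
    monomial 1 (ofNichols M (NicholsAlgebra.ι M v)) := by
  simp [gr]

@[simp]
theorem gr_ofGroup (γ : Γ) : gr M (ofGroup M γ) = C (ofGroup M γ) := by
  simp [gr]

@[simp]
theorem toGroupAlgebra_ι (v : V) :
    toGroupAlgebra M (ofNichols M (NicholsAlgebra.ι M v)) = 0 := by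
  simp [toGroupAlgebra, NicholsAlgebra.counit_ι]

@[simp]
theorem toGroupAlgebra_ofGroup (γ : Γ) :
    toGroupAlgebra M (ofGroup M γ) = MonoidAlgebra.single γ 1 := by
  simp [toGroupAlgebra]

theorem coeff_zero_gr (y : M.Bosonization) :
    (gr M y).coeff 0 = ofGroupAlgebra M (toGroupAlgebra M y) := by
  have h : (eval₂AlgHom (AlgHom.id k _) 0 fun _ => Commute.zero_right _).comp (gr M) =
      (ofGroupAlgebra M).comp (toGroupAlgebra M) :=
    hom_ext M (fun γ => by simp [ofGroupAlgebra_single]) fun g v _ => by simp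
  rw [coeff_zero_eq_eval_zero]
  exact DFunLike.congr_fun h y

theorem eval_one_gr (y : M.Bosonization) : (gr M y).eval 1 = y := by
  have h : (eval₂AlgHom (AlgHom.id k _) 1 fun _ => Commute.one_right _).comp (gr M) =
      AlgHom.id k _ :=
    hom_ext M (fun γ => by simp) fun g v _ => by simp
  exact DFunLike.congr_fun h y

/-- The algebra map `A[X] ⊗ A[X] → (A ⊗ A)[X]` that multiplies the powers of `X`. -/
def mulPowers (A : Type*) [Ring A] [Algebra k A] : A[X] ⊗[k] A[X] →ₐ[k] (A ⊗[k] A)[X] :=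
  Algebra.TensorProduct.lift (mapAlgHom Algebra.TensorProduct.includeLeft)
    (mapAlgHom Algebra.TensorProduct.includeRight) fun p q => by
      induction p using Polynomial.induction_on' with
      | add p p' hp hp' => simpa only [map_add] using hp.add_left hp'
      | monomial m a =>
        induction q using Polynomial.induction_on' with
        | add q q' hq hq' => simpa only [map_add] using hq.add_right hq'
        | monomial n b => simp [Commute, SemiconjBy, monomial_mul_monomial, add_comm]

@[simp]
theorem mulPowers_monomial_tmul_monomial {A : Type*} [Ring A] [Algebra k A] (m n : ℕ) (a b : A) :
    mulPowers A (monomial m a ⊗ₜ[k] monomial n b) = monomial (m + n) (a ⊗ₜ b) := by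
  simp [mulPowers, monomial_mul_monomial]

theorem map_comulHom_gr (y : M.Bosonization) :
    mapAlgHom (comulHom M) (gr M y) =
      mulPowers M.Bosonization (Algebra.TensorProduct.map (gr M) (gr M) (comulHom M y)) := by
  have h : (mapAlgHom (comulHom M)).comp (gr M) = (mulPowers M.Bosonization).comp
      ((Algebra.TensorProduct.map (gr M) (gr M)).comp (comulHom M)) :=
    hom_ext (B := (M.Bosonization ⊗[k] M.Bosonization)[X]) M
      (fun γ => by simp [comulHom_ofGroup, ← monomial_zero_left])
      fun g v hv => by simp [comulHom_ι M hv, ← monomial_zero_left, ← monomial_zero_one]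
  exact DFunLike.congr_fun h y

theorem map_toGroupAlgebra_right_comulHom (r : M.NicholsAlgebra) :
    Algebra.TensorProduct.map (AlgHom.id k _) (toGroupAlgebra M) (comulHom M (ofNichols M r)) =
      ofNichols M r ⊗ₜ 1 := by
  have h : ((Algebra.TensorProduct.map (AlgHom.id k _) (toGroupAlgebra M)).comp
      (comulHom M)).comp (ofNichols M) =
      Algebra.TensorProduct.includeLeft.comp (ofNichols M) :=
    algHom_ext_homogeneous M fun g v hv => by simp [comulHom_ι M hv]
  exact DFunLike.congr_fun h r

theorem map_toGroupAlgebra_left_comulHom (r : M.NicholsAlgebra) :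
    Algebra.TensorProduct.map (toGroupAlgebra M) (AlgHom.id k _) (comulHom M (ofNichols M r)) =
      Algebra.TensorProduct.map (AlgHom.id k _) (ofNichols M) (NicholsAlgebra.coact M r) := by
  have h : ((Algebra.TensorProduct.map (toGroupAlgebra M) (AlgHom.id k _)).comp
      (comulHom M)).comp (ofNichols M) =
      (Algebra.TensorProduct.map (AlgHom.id k _) (ofNichols M)).comp (NicholsAlgebra.coact M) :=
    algHom_ext_homogeneous M fun g v hv => by
      simp [comulHom_ι M hv, NicholsAlgebra.coact_ι, hv]
  exact DFunLike.congr_fun h r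

end Bosonization

/-! ### Group-like elements -/

theorem tmul_self_eq_zero {A : Type*} [AddCommGroup A] [Module k A] {a : A} (h : a ⊗ₜ[k] a = 0) :
    a = 0 := by
  refine (Module.forall_dual_apply_eq_zero_iff k a).1 fun f => mul_self_eq_zero.1 ?_
  simpa using congrArg (LinearMap.mul' k k ∘ₗ TensorProduct.map f f) h

namespace Bosonization

variable (M : YDModule k Γ V)

theorem ofNichols_injective : Function.Injective (ofNichols M) :=
  SkewMonoidAlgebra.single_injective 1

theorem ofGroup_injective : Function.Injective (ofGroup M) := fun γ γ' h => by
  have : Nontrivial M.NicholsAlgebra := (NicholsAlgebra.counit M).toRingHom.domain_nontrivial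
  exact (SkewMonoidAlgebra.single_left_inj one_ne_zero).1 h

theorem isGroupLikeElem_ofGroup (γ : Γ) : IsGroupLikeElem k (ofGroup M γ) where
  counit_eq_one := counitHom_ofGroup M γ
  comul_eq_tmul_self := comulHom_ofGroup M γ

/-- `toGroupAlgebra` as a homomorphism of bialgebras. -/
def toGroupAlgebraBialgHom : M.Bosonization →ₐc[k] MonoidAlgebra k Γ :=
  .ofAlgHom (toGroupAlgebra M)
    (hom_ext M (f' := counitHom M) (fun γ => by simp [counitHom_ofGroup])
      fun g v _ => by simp [counitHom_ι])
    (hom_ext M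
      (f := (Algebra.TensorProduct.map (toGroupAlgebra M) (toGroupAlgebra M)).comp (comulHom M))
      (fun γ => by simp [comulHom_ofGroup])
      fun g v hv => by simp [comulHom_ι M hv])

variable {M} {y : M.Bosonization}

theorem natDegree_gr_of_isGroupLikeElem (hy : IsGroupLikeElem k y) : (gr M y).natDegree = 0 := by
  by_contra hN
  set N := (gr M y).natDegree
  have h : mapAlgHom (comulHom M) (gr M y) = mulPowers _ (gr M y ⊗ₜ gr M y) := by
    rw [map_comulHom_gr, show comulHom M y = y ⊗ₜ y from hy.comul_eq_tmul_self]
    rfl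
  have hl : (mapAlgHom (comulHom M) (gr M y)).coeff (N + N) = 0 := by
    rw [coe_mapAlgHom, coeff_map, coeff_eq_zero_of_natDegree_lt (by omega), map_zero]
  have hr : (mulPowers _ (gr M y ⊗ₜ gr M y)).coeff (N + N) =
      (gr M y).leadingCoeff ⊗ₜ[k] (gr M y).leadingCoeff := by
    rw [mulPowers, Algebra.TensorProduct.lift_tmul, coe_mapAlgHom, coe_mapAlgHom,
      coeff_mul_add_eq_of_natDegree_le natDegree_map_le natDegree_map_le]
    simp
  rw [h, hr] at hl
  have h0 : gr M y = 0 := leadingCoeff_eq_zero.1 (tmul_self_eq_zero hl)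
  exact hN ((congrArg natDegree h0).trans natDegree_zero)

theorem isGroupLikeElem_iff_mem_range_ofGroup :
    IsGroupLikeElem k y ↔ y ∈ Set.range (ofGroup M) := by
  refine ⟨fun hy => ?_, fun ⟨γ, hγ⟩ => hγ ▸ isGroupLikeElem_ofGroup M γ⟩
  obtain ⟨γ, hγ⟩ := MonoidAlgebra.isGroupLikeElem_iff_mem_range_of.1
    (hy.map (toGroupAlgebraBialgHom M))
  replace hγ : MonoidAlgebra.single γ 1 = toGroupAlgebra M y := hγ
  refine ⟨γ, ?_⟩
  rw [← eval_one_gr M y, eq_C_of_natDegree_eq_zero (natDegree_gr_of_isGroupLikeElem hy),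
    eval_C, coeff_zero_gr, ← hγ, ofGroupAlgebra_single]

end Bosonization

/-! ### Skew primitive elements -/

namespace Bosonization

/-- The `(g, 1)`-skew primitive elements of `𝔅(V) # kΓ` on which `Γ` acts, by conjugation, through
the character `χ`. -/
structure IsSkewPrimitive (M : YDModule k Γ V) (g : Γ) (χ : Γ →* kˣ) (y : M.Bosonization) :
    Prop where
  comul_eq : comulHom M y = y ⊗ₜ 1 + ofGroup M g ⊗ₜ y
  ofGroup_mul (γ : Γ) : ofGroup M γ * y = (χ γ : k) • (y * ofGroup M γ)

variable {M : YDModule k Γ V} {g : Γ} {χ : Γ →* kˣ} {y : M.Bosonization} {r : M.NicholsAlgebra}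

theorem isUnit_ofGroup (γ : Γ) : IsUnit (ofGroup M γ) :=
  (Group.isUnit γ).map (ofGroup M)

theorem IsSkewPrimitive.toGroupAlgebra_eq_zero (hy : IsSkewPrimitive M g χ y) (hχ : χ ≠ 1) :
    toGroupAlgebra M y = 0 := by
  obtain ⟨γ, hγ⟩ := DFunLike.ne_iff.1 hχ
  have h := congrArg (toGroupAlgebra M) (hy.ofGroup_mul γ)
  rw [map_smul, map_mul, map_mul, mul_comm, ← smul_mul_assoc] at h
  have h' := ((isUnit_ofGroup γ).map (toGroupAlgebra M)).mul_left_injective h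
  have h0 : ((χ γ : k) - 1) • toGroupAlgebra M y = 0 := by rw [sub_smul, one_smul, ← h', sub_self]
  exact (smul_eq_zero.1 h0).resolve_left (sub_ne_zero.2 (Units.val_eq_one.not.2 hγ))

variable (M) in
/-- Radford's projection `y ↦ y₁ S(π(y₂))` of `𝔅(V) # kΓ` onto `𝔅(V)`, where `π` is
`toGroupAlgebra`. -/
def radfordProj : M.Bosonization →ₗ[k] M.Bosonization :=
  LinearMap.mul' k _ ∘ₗ ((ofGroupAlgebra M).toLinearMap ∘ₗ HopfAlgebra.antipode k).lTensor _ ∘ₗ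
    (Algebra.TensorProduct.map (AlgHom.id k _) (toGroupAlgebra M)).toLinearMap ∘ₗ
    (comulHom M).toLinearMap

@[simp]
theorem radfordProj_ofNichols_mul_ofGroup (r : M.NicholsAlgebra) (γ : Γ) :
    radfordProj M (ofNichols M r * ofGroup M γ) = ofNichols M r := by
  have h : Algebra.TensorProduct.map (AlgHom.id k _) (toGroupAlgebra M)
      (comulHom M (ofNichols M r * ofGroup M γ)) =
        (ofNichols M r * ofGroup M γ) ⊗ₜ MonoidAlgebra.single γ 1 := by
    rw [map_mul, map_mul, map_toGroupAlgebra_right_comulHom, comulHom_ofGroup]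
    simp
  simp only [radfordProj, LinearMap.comp_apply, AlgHom.toLinearMap_apply, h]
  simp [ofGroupAlgebra_single, mul_assoc, ← map_mul]

@[simp]
theorem radfordProj_ofNichols_mul_ofGroupAlgebra (r : M.NicholsAlgebra) (h : MonoidAlgebra k Γ) :
    radfordProj M (ofNichols M r * ofGroupAlgebra M h) =
      Coalgebra.counit (R := k) h • ofNichols M r := by
  induction h using MonoidAlgebra.induction_on with
  | of γ => simp [ofGroupAlgebra_single]
  | add h h' hh hh' => simp only [map_add, mul_add, hh, hh', add_smul]
  | smul c h hh => simp [hh, smul_smul]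

theorem radfordProj_mem_range_ofNichols (y : M.Bosonization) :
    radfordProj M y ∈ (ofNichols M).range := by
  induction y using SkewMonoidAlgebra.induction_on with
  | zero => simp
  | add x y hx hy => rw [map_add]; exact add_mem hx hy
  | single γ r => exact ⟨r, by rw [← ofNichols_mul_ofGroup, radfordProj_ofNichols_mul_ofGroup]; rfl⟩

theorem IsSkewPrimitive.exists_ofNichols_eq (hy : IsSkewPrimitive M g χ y) (hχ : χ ≠ 1) :
    ∃ r, ofNichols M r = y := by
  have h : radfordProj M y = y := by
    simp [radfordProj, hy.comul_eq, hy.toGroupAlgebra_eq_zero hχ]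
  exact h ▸ radfordProj_mem_range_ofNichols y

theorem IsSkewPrimitive.smul_eq (hr : IsSkewPrimitive M g χ (ofNichols M r)) (γ : Γ) :
    γ • r = (χ γ : k) • r := by
  have h := hr.ofGroup_mul γ
  rw [ofGroup_mul_ofNichols, ← smul_mul_assoc, ← map_smul] at h
  exact ofNichols_injective M ((isUnit_ofGroup γ).mul_left_injective h)

theorem IsSkewPrimitive.coact_eq (hr : IsSkewPrimitive M g χ (ofNichols M r)) (hχ : χ ≠ 1) :
    NicholsAlgebra.coact M r = MonoidAlgebra.single g 1 ⊗ₜ r := by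
  have h := map_toGroupAlgebra_left_comulHom M r
  rw [hr.comul_eq, map_add, Algebra.TensorProduct.map_tmul, Algebra.TensorProduct.map_tmul,
    hr.toGroupAlgebra_eq_zero hχ, TensorProduct.zero_tmul, zero_add, toGroupAlgebra_ofGroup] at h
  exact (Module.Flat.lTensor_preserves_injective_linearMap (ofNichols M).toLinearMap
    (ofNichols_injective M) h).symm

theorem IsSkewPrimitive.coeff_gr (hy : IsSkewPrimitive M g χ y) (n : ℕ) :
    IsSkewPrimitive M g χ ((gr M y).coeff n) where
  comul_eq := by
    have h := congrArg (coeff · n) (map_comulHom_gr M y)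
    simpa [hy.comul_eq, mulPowers] using h
  ofGroup_mul γ := by
    simpa using congrArg (coeff · n) (congrArg (gr M) (hy.ofGroup_mul γ))

end Bosonization

instance isTwoSided_span_X_pow {A : Type*} [Ring A] (n : ℕ) :
    (Ideal.span {(X ^ n : A[X])}).IsTwoSided := ⟨fun {p} q hp => by
  obtain ⟨p, rfl⟩ := Ideal.mem_span_singleton'.1 hp
  rw [mul_assoc, (commute_X_pow q n).eq, ← mul_assoc]
  exact Ideal.mul_mem_left _ _ (Ideal.mem_span_singleton_self _)⟩

section QuotientBy

variable {A C : Type*} [Ring A] [Algebra k A] [Ring C] [Algebra k C]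

/-- The quotient of a ring by the two-sided ideal generated by `a`. -/
abbrev QuotientBy (a : A) : Type _ :=
  RingQuot fun b c : A => b = a ∧ c = 0

variable (k) in
/-- The quotient map of `QuotientBy a`. -/
abbrev toQuotientBy (a : A) : A →ₐ[k] QuotientBy a :=
  RingQuot.mkAlgHom k _

theorem toQuotientBy_self (a : A) : toQuotientBy k a a = 0 :=
  (RingQuot.mkAlgHom_rel k ⟨rfl, rfl⟩).trans (map_zero _)

theorem exists_comp_toQuotientBy {a : A} (f : A →ₐ[k] C) (ha : f a = 0) :
    ∃ f' : QuotientBy a →ₐ[k] C, f'.comp (toQuotientBy k a) = f := by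
  refine ⟨RingQuot.liftAlgHom k ⟨f, ?_⟩, AlgHom.ext fun b => RingQuot.liftAlgHom_mkAlgHom_apply ..⟩
  rintro _ _ ⟨rfl, rfl⟩
  rw [ha, map_zero]

theorem map_eq_zero_of_toQuotientBy_eq_zero {a : A} (f : A →ₐ[k] C) (ha : f a = 0) {b : A}
    (hb : toQuotientBy k a b = 0) : f b = 0 := by
  obtain ⟨f', rfl⟩ := exists_comp_toQuotientBy f ha
  rw [AlgHom.comp_apply, hb, map_zero]

theorem coeff_eq_zero_of_toQuotientBy_eq_zero {a b : A} (f : A →ₐ[k] C[X]) {m : ℕ}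
    (ha : ∀ n < m, (f a).coeff n = 0) (hb : toQuotientBy k a b = 0) {n : ℕ} (hn : n < m) :
    (f b).coeff n = 0 := by
  let I : Ideal C[X] := Ideal.span {X ^ m}
  have mem_I {p : C[X]} : p ∈ I ↔ ∀ n < m, p.coeff n = 0 := by
    rw [← X_pow_dvd_iff, Ideal.mem_span_singleton']
    exact ⟨fun ⟨q, hq⟩ => ⟨q, by rw [← hq, (commute_X_pow q m).eq]⟩,
      fun ⟨q, hq⟩ => ⟨q, by rw [hq, (commute_X_pow q m).eq]⟩⟩
  refine mem_I.1 (Ideal.Quotient.eq_zero_iff_mem.1 ?_) n hn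
  exact map_eq_zero_of_toQuotientBy_eq_zero ((Ideal.Quotient.mkₐ k I).comp f)
    (Ideal.Quotient.eq_zero_iff_mem.2 (mem_I.2 ha)) hb

end QuotientBy

namespace Bosonization

variable {M : YDModule k Γ V} {g : Γ} {χ : Γ →* kˣ} {r : M.NicholsAlgebra}

theorem exists_radfordProj_toQuotientBy (r : M.NicholsAlgebra) :
    ∃ P : QuotientBy (ofNichols M r) →ₗ[k] QuotientBy (ofNichols M r),
      P ∘ₗ (toQuotientBy k (ofNichols M r)).toLinearMap =
        (toQuotientBy k (ofNichols M r)).toLinearMap ∘ₗ radfordProj M := by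
  set q := toQuotientBy k (ofNichols M r)
  have hr : (Algebra.TensorProduct.map q (toGroupAlgebra M)).comp (comulHom M) (ofNichols M r) =
      0 := by
    have h := congrArg (Algebra.TensorProduct.map q (AlgHom.id k _))
      (map_toGroupAlgebra_right_comulHom M r)
    rw [← AlgHom.comp_apply, ← Algebra.TensorProduct.map_comp, Algebra.TensorProduct.map_tmul,
      toQuotientBy_self, TensorProduct.zero_tmul] at h
    exact h
  obtain ⟨R, hR⟩ := exists_comp_toQuotientBy _ hr
  refine ⟨LinearMap.mul' k _ ∘ₗ (q.toLinearMap ∘ₗ (ofGroupAlgebra M).toLinearMap ∘ₗ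
    HopfAlgebra.antipode k).lTensor _ ∘ₗ R.toLinearMap, LinearMap.ext fun y => ?_⟩
  have hy : R (q y) = Algebra.TensorProduct.map q (toGroupAlgebra M) (comulHom M y) :=
    DFunLike.congr_fun hR y
  simp only [LinearMap.comp_apply, AlgHom.toLinearMap_apply, hy, radfordProj]
  generalize comulHom M y = z
  induction z using TensorProduct.induction_on with
  | zero => simp
  | add z z' hz hz' => simp only [map_add, hz, hz']
  | tmul a b => simp

theorem rTensor_radfordProj_comulAux_one (X : M.NicholsAlgebra ⊗[k] M.NicholsAlgebra) :
    (radfordProj M).rTensor _ (comulAux M 1 X) =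
      TensorProduct.map (ofNichols M).toLinearMap (ofNichols M).toLinearMap X := by
  induction X using TensorProduct.induction_on with
  | zero => simp
  | add x y hx hy => simp only [map_add, hx, hy]
  | tmul a b =>
    conv_rhs => rw [← NicholsAlgebra.counit_coact M b]
    rw [comulAux_tmul, map_one, ← Algebra.TensorProduct.one_def, mul_one]
    generalize NicholsAlgebra.coact M b = z
    induction z using TensorProduct.induction_on with
    | zero => simp
    | add x y hx hy => simp only [map_add, mul_add, hx, hy, TensorProduct.tmul_add]
    | tmul h s =>
      simp [incl, TensorProduct.smul_tmul']

theorem map_comul_eq_rTensor_map_comulHom {B : Type*} [Ring B] [Algebra k B]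
    {q : M.Bosonization →ₐ[k] B} {P : B →ₗ[k] B}
    (hP : P ∘ₗ q.toLinearMap = q.toLinearMap ∘ₗ radfordProj M) (s : M.NicholsAlgebra) :
    TensorProduct.map (q.comp (ofNichols M)).toLinearMap (q.comp (ofNichols M)).toLinearMap
        (NicholsAlgebra.comul M s) =
      P.rTensor _ (TensorProduct.map q.toLinearMap q.toLinearMap (comulHom M (ofNichols M s))) := by
  have hs : comulHom M (ofNichols M s) = comulAux M 1 (NicholsAlgebra.comul M s) :=
    comul_single M 1 s
  have hPq : P.rTensor B ∘ₗ TensorProduct.map q.toLinearMap q.toLinearMap =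
      TensorProduct.map q.toLinearMap q.toLinearMap ∘ₗ (radfordProj M).rTensor _ := by
    rw [LinearMap.rTensor_comp_map, hP, LinearMap.map_comp_rTensor]
  rw [← LinearMap.comp_apply (P.rTensor B), hPq, LinearMap.comp_apply, hs,
    rTensor_radfordProj_comulAux_one, AlgHom.comp_toLinearMap, TensorProduct.map_comp,
    LinearMap.comp_apply]

theorem IsSkewPrimitive.injective_toQuotientBy (hr : IsSkewPrimitive M g χ (ofNichols M r))
    (hχ : χ ≠ 1) {m : ℕ} (hm : 2 ≤ m) (hgr : NicholsAlgebra.gr M r = monomial m r) :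
    Function.Injective ((toQuotientBy k (ofNichols M r)).comp (ofNichols M)) := by
  set q := toQuotientBy k (ofNichols M r)
  have hq : q (ofNichols M r) = 0 := toQuotientBy_self _
  have hgr' : gr M (ofNichols M r) = monomial m (ofNichols M r) := by
    rw [gr_ofNichols, hgr, coe_mapAlgHom, map_monomial]
    rfl
  refine NicholsAlgebra.injective_of_hopf_ker M (fun s hs => ?_) (fun s hs n hn => ?_)
    (fun γ s hs => ?_) (fun s hs => ?_) (fun s hs => ?_)
  · have h := map_eq_zero_of_toQuotientBy_eq_zero (b := ofNichols M s)
      ((mapAlgHom q).comp (gr M)) (by simp [hgr', hq]) hs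
    rw [AlgHom.comp_apply, gr_ofNichols] at h
    rwa [← mapAlgHom_comp]
  · have h := coeff_eq_zero_of_toQuotientBy_eq_zero (b := ofNichols M s) (gr M)
      (fun n hn => ?_) hs (hn.trans_le hm)
    · rwa [gr_ofNichols, coe_mapAlgHom, coeff_map, AlgHom.coe_toRingHom,
        map_eq_zero_iff _ (ofNichols_injective M)] at h
    · rw [hgr', coeff_monomial_of_ne _ hn.ne]
  · refine (((isUnit_ofGroup γ).map q).mul_left_eq_zero).1 ?_
    rw [AlgHom.comp_apply, ← map_mul, ← ofGroup_mul_ofNichols, map_mul]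
    exact mul_eq_zero_of_right _ hs
  · have h := map_eq_zero_of_toQuotientBy_eq_zero
      ((Algebra.TensorProduct.map (toGroupAlgebra M) q).comp (comulHom M))
      (by simp [hr.comul_eq, hr.toGroupAlgebra_eq_zero hχ, hq]) hs
    rw [Algebra.TensorProduct.map_id_comp, AlgHom.comp_apply, ← map_toGroupAlgebra_left_comulHom,
      ← AlgHom.comp_apply, ← Algebra.TensorProduct.map_comp]
    exact h
  · obtain ⟨P, hP⟩ := exists_radfordProj_toQuotientBy r
    have h := map_eq_zero_of_toQuotientBy_eq_zero
      ((Algebra.TensorProduct.map q q).comp (comulHom M)) (by simp [hr.comul_eq, hq]) hs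
    rw [map_comul_eq_rTensor_map_comulHom hP]
    exact (congrArg _ h).trans (map_zero _)

end Bosonization

/-- The vectors of degree `g` and weight `χ`, denoted `V_g^χ` in the literature. -/
def component (M : YDModule k Γ V) (g : Γ) (χ : Γ →* kˣ) : Submodule k V where
  carrier := {v | M.coact v = MonoidAlgebra.single g 1 ⊗ₜ v ∧ ∀ γ, M.act γ v = (χ γ : k) • v}
  zero_mem' := by simp
  add_mem' hv hw := ⟨by rw [map_add, hv.1, hw.1, TensorProduct.tmul_add],
    fun γ => by rw [map_add, hv.2, hw.2, smul_add]⟩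
  smul_mem' c v hv := ⟨by rw [map_smul, hv.1, TensorProduct.tmul_smul],
    fun γ => by rw [map_smul, hv.2, smul_comm]⟩

namespace Bosonization

section

variable {M : YDModule k Γ V} {g : Γ} {χ : Γ →* kˣ} {v : V} {y : M.Bosonization}
  {r : M.NicholsAlgebra}

theorem IsSkewPrimitive.eq_zero_of_two_le (hr : IsSkewPrimitive M g χ (ofNichols M r))
    (hχ : χ ≠ 1) {m : ℕ} (hm : 2 ≤ m) (hgr : NicholsAlgebra.gr M r = monomial m r) : r = 0 :=
  hr.injective_toQuotientBy hχ hm hgr ((toQuotientBy_self _).trans (map_zero _).symm)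

theorem IsSkewPrimitive.gr_eq (hy : IsSkewPrimitive M g χ y) (hχ : χ ≠ 1) :
    gr M y = monomial 1 ((gr M y).coeff 1) := by
  ext n
  rcases eq_or_ne n 1 with rfl | h1
  · rw [coeff_monomial_same]
  rw [coeff_monomial_of_ne _ h1]
  rcases eq_or_ne n 0 with rfl | h0
  · rw [coeff_zero_gr, hy.toGroupAlgebra_eq_zero hχ, map_zero]
  obtain ⟨r, rfl⟩ := hy.exists_ofNichols_eq hχ
  have hn := hy.coeff_gr n
  simp only [gr_ofNichols, coe_mapAlgHom, coeff_map, AlgHom.coe_toRingHom] at hn ⊢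
  rw [hn.eq_zero_of_two_le hχ (by omega) (NicholsAlgebra.gr_coeff_gr M r n), map_zero]

theorem isSkewPrimitive_of_mem_component (hv : v ∈ M.component g χ) :
    IsSkewPrimitive M g χ (ofNichols M (NicholsAlgebra.ι M v)) where
  comul_eq := comulHom_ι M hv.1
  ofGroup_mul γ := by
    rw [ofGroup_mul_ofNichols, NicholsAlgebra.smul_ι, hv.2, map_smul, map_smul, smul_mul_assoc]

theorem IsSkewPrimitive.mem_component
    (hv : IsSkewPrimitive M g χ (ofNichols M (NicholsAlgebra.ι M v))) (hχ : χ ≠ 1) :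
    v ∈ M.component g χ := by
  refine ⟨?_, fun γ => NicholsAlgebra.ι_injective M ?_⟩
  · have h := hv.coact_eq hχ
    rw [NicholsAlgebra.coact_ι] at h
    exact Module.Flat.lTensor_preserves_injective_linearMap _ (NicholsAlgebra.ι_injective M) h
  · rw [← NicholsAlgebra.smul_ι, hv.smul_eq, map_smul]

theorem isSkewPrimitive_iff_exists_mem_component (hχ : χ ≠ 1) :
    IsSkewPrimitive M g χ y ↔
      ∃ v ∈ M.component g χ, ofNichols M (NicholsAlgebra.ι M v) = y := by
  refine ⟨fun hy => ?_, fun ⟨v, hv, hy⟩ => hy ▸ isSkewPrimitive_of_mem_component hv⟩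
  obtain ⟨v, hv⟩ : ∃ v, ofNichols M (NicholsAlgebra.ι M v) = y := by
    obtain ⟨r, rfl⟩ := hy.exists_ofNichols_eq hχ
    obtain ⟨v, hv⟩ := NicholsAlgebra.coeff_one_gr_mem_range_ι M r
    refine ⟨v, ?_⟩
    rw [hv, ← eval_one_gr M (ofNichols M r), hy.gr_eq hχ, gr_ofNichols]
    simp
  subst hv
  exact ⟨v, hy.mem_component hχ, rfl⟩

end

end Bosonization

/-! ### Twisted automorphisms -/

/-- A linear automorphism `φ` of `V` that is an isomorphism from `V` to the Yetter-Drinfeld module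
obtained from `V` by transport of the action and the coaction along the automorphism `ψ` of
`Γ`. -/
structure IsTwistedAut (M : YDModule k Γ V) (φ : V ≃ₗ[k] V) (ψ : Γ ≃* Γ) : Prop where
  map_act : ∀ γ v, φ (M.act γ v) = M.act (ψ γ) (φ v)
  coact_map : ∀ v, M.coact (φ v) =
    TensorProduct.congr (MonoidAlgebra.domCongr k k ψ).toLinearEquiv φ (M.coact v)

/-- The algebra endomorphism of `T(V)` induced by a linear automorphism of `V`. -/
def tMap (φ : V ≃ₗ[k] V) : TensorAlgebra k V →ₐ[k] TensorAlgebra k V :=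
  TensorAlgebra.lift k (TensorAlgebra.ι k ∘ₗ φ.toLinearMap)

@[simp]
theorem tMap_ι (φ : V ≃ₗ[k] V) (v : V) :
    tMap φ (TensorAlgebra.ι k v) = TensorAlgebra.ι k (φ v) := by
  simp [tMap]

theorem tMap_symm_tMap (φ : V ≃ₗ[k] V) (t : TensorAlgebra k V) : tMap φ.symm (tMap φ t) = t := by
  have : (tMap φ.symm).comp (tMap φ) = AlgHom.id k _ := by
    ext v; simp
  exact DFunLike.congr_fun this t

theorem tGr_tMap (φ : V ≃ₗ[k] V) (t : TensorAlgebra k V) :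
    tGr (tMap φ t) = mapAlgHom (tMap φ) (tGr t) := by
  have : tGr.comp (tMap φ) = (mapAlgHom (tMap φ)).comp tGr := by
    ext v : 2; simp
  exact DFunLike.congr_fun this t

namespace IsTwistedAut

variable {M : YDModule k Γ V} {φ : V ≃ₗ[k] V} {ψ : Γ ≃* Γ}

theorem symm (h : M.IsTwistedAut φ ψ) : M.IsTwistedAut φ.symm ψ.symm where
  map_act γ v := by
    apply φ.injective
    rw [h.map_act, ψ.apply_symm_apply, φ.apply_symm_apply, φ.apply_symm_apply]
  coact_map v := by
    obtain ⟨w, rfl⟩ := φ.surjective v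
    rw [h.coact_map, φ.symm_apply_apply]
    exact ((TensorProduct.congr (MonoidAlgebra.domCongr k k ψ).toLinearEquiv φ).symm_apply_apply
      (M.coact w)).symm

theorem coact_homogeneous (h : M.IsTwistedAut φ ψ) {g : Γ} {v : V}
    (hv : M.coact v = MonoidAlgebra.single g 1 ⊗ₜ v) :
    M.coact (φ v) = MonoidAlgebra.single (ψ g) 1 ⊗ₜ φ v := by
  rw [h.coact_map, hv, TensorProduct.congr_tmul]
  simp

theorem map_mem_component (h : M.IsTwistedAut φ ψ) {g : Γ} {χ : Γ →* kˣ} {v : V}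
    (hv : v ∈ M.component g χ) : φ v ∈ M.component (ψ g) (χ.comp ψ.symm.toMonoidHom) := by
  refine ⟨h.coact_homogeneous hv.1, fun γ => ?_⟩
  obtain ⟨γ, rfl⟩ := ψ.surjective γ
  rw [← h.map_act, hv.2, map_smul]
  simp

theorem of_span {s : Set V} (hs : Submodule.span k s = ⊤)
    (h : ∀ v ∈ s, ∃ g χ, v ∈ M.component g χ ∧
      φ v ∈ M.component (ψ g) (χ.comp ψ.symm.toMonoidHom)) : M.IsTwistedAut φ ψ where
  map_act γ v := by
    refine LinearMap.congr_fun (f := φ.toLinearMap ∘ₗ M.act γ)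
      (g := M.act (ψ γ) ∘ₗ φ.toLinearMap) (LinearMap.ext_on hs fun v hv => ?_) v
    obtain ⟨g, χ, hv, hφv⟩ := h v hv
    simp [hv.2, hφv.2]
  coact_map v := by
    refine LinearMap.congr_fun (f := M.coact ∘ₗ φ.toLinearMap)
      (g := (TensorProduct.congr (MonoidAlgebra.domCongr k k ψ).toLinearEquiv φ).toLinearMap ∘ₗ
        M.coact) (LinearMap.ext_on hs fun v hv => ?_) v
    obtain ⟨g, χ, hv, hφv⟩ := h v hv
    simp [hv.1, hφv.1]

theorem tMap_tAct (h : M.IsTwistedAut φ ψ) (γ : Γ) (t : TensorAlgebra k V) :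
    tMap φ (M.tAct γ t) = M.tAct (ψ γ) (tMap φ t) := by
  have : (tMap φ).comp (M.tAct γ) = (M.tAct (ψ γ)).comp (tMap φ) := by
    ext v; simp [h.map_act]
  exact DFunLike.congr_fun this t

theorem tCoact_tMap (h : M.IsTwistedAut φ ψ) (t : TensorAlgebra k V) :
    M.tCoact (tMap φ t) = Algebra.TensorProduct.map
      (MonoidAlgebra.domCongr k k ψ : MonoidAlgebra k Γ →ₐ[k] MonoidAlgebra k Γ) (tMap φ)
        (M.tCoact t) := by
  refine LinearMap.congr_fun (f := M.tCoact.toLinearMap ∘ₗ (tMap φ).toLinearMap)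
    (g := (Algebra.TensorProduct.map (MonoidAlgebra.domCongr k k ψ :
      MonoidAlgebra k Γ →ₐ[k] MonoidAlgebra k Γ) (tMap φ)).toLinearMap ∘ₗ
        M.tCoact.toLinearMap) (M.tensor_hom_ext_homogeneous ?_ fun g v t hv ht => ?_) t
  · simp only [LinearMap.comp_apply, AlgHom.toLinearMap_apply, map_one]
  · simp only [LinearMap.comp_apply, AlgHom.toLinearMap_apply] at ht ⊢
    rw [map_mul, map_mul, ht, map_mul, map_mul, tMap_ι, tCoact_ι, tCoact_ι, hv,
      h.coact_homogeneous hv]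
    simp

theorem tComul_tMap (h : M.IsTwistedAut φ ψ) (t : TensorAlgebra k V) :
    M.tComul (tMap φ t) =
      TensorProduct.map (tMap φ).toLinearMap (tMap φ).toLinearMap (M.tComul t) := by
  refine LinearMap.congr_fun (f := M.tComul ∘ₗ (tMap φ).toLinearMap)
    (g := TensorProduct.map (tMap φ).toLinearMap (tMap φ).toLinearMap ∘ₗ M.tComul)
    (M.tensor_hom_ext_homogeneous ?_ fun g v t hv ht => ?_) t
  · simp [tComul_one]
  · simp only [LinearMap.comp_apply, AlgHom.toLinearMap_apply] at ht ⊢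
    rw [map_mul, tMap_ι, M.tComul_ι_mul, ht, M.tComul_ι_mul]
    induction M.tComul t with
    | zero => simp only [map_zero]
    | add x y hx hy => simp only [map_add (TensorProduct.map _ _), map_add (M.braidedMul _), hx, hy]
    | tmul a b =>
      rw [TensorProduct.map_tmul, M.braidedMul_ι hv, M.braidedMul_ι (h.coact_homogeneous hv)]
      simp [h.tMap_tAct]

theorem isHopfIdeal_ker (h : M.IsTwistedAut φ ψ) :
    M.IsHopfIdeal (RingHom.ker ((NicholsAlgebra.mk M).comp (tMap φ))) := by
  refine YDModule.isHopfIdeal_ker M (fun t ht => ?_) (fun t ht n hn => ?_) (fun γ t ht => ?_)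
    (fun t ht => ?_) (fun t ht => ?_)
  all_goals replace ht : NicholsAlgebra.mk M (tMap φ t) = 0 := ht
  · rw [← mapAlgHom_comp, AlgHom.comp_apply, ← tGr_tMap]
    exact (congrArg (NicholsAlgebra.gr M) ht).trans (map_zero _)
  · have h0 : tMap φ ((tGr t).coeff n) = 0 := by
      have := M.isHopfIdeal_nicholsIdeal.proj_eq_zero _ ((NicholsAlgebra.mk_eq_zero M _).1 ht) n hn
      rwa [← coeff_tGr, tGr_tMap, coe_mapAlgHom, coeff_map] at this
    rw [← tMap_symm_tMap φ ((tGr t).coeff n), h0, map_zero]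
  · rw [AlgHom.comp_apply, h.tMap_tAct, ← NicholsAlgebra.act_mk, ht, map_zero]
  · have h0 : Algebra.TensorProduct.map (AlgHom.id k _) (NicholsAlgebra.mk M)
        (M.tCoact (tMap φ t)) = 0 :=
      (congrArg (NicholsAlgebra.coact M) ht).trans (map_zero _)
    apply (Algebra.TensorProduct.congr (MonoidAlgebra.domCongr k k ψ) AlgEquiv.refl).injective
    rw [map_zero, ← h0, h.tCoact_tMap]
    induction M.tCoact t with
    | zero => simp only [map_zero]
    | add x y hx hy => simp only [map_add, hx, hy]
    | tmul a b => simp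
  · have h0 : TensorProduct.map (NicholsAlgebra.mk M).toLinearMap (NicholsAlgebra.mk M).toLinearMap
        (M.tComul (tMap φ t)) = 0 :=
      (congrArg (NicholsAlgebra.comul M) ht).trans (map_zero _)
    rw [h.tComul_tMap, ← LinearMap.comp_apply, ← TensorProduct.map_comp] at h0
    exact h0

theorem tMap_mem_nicholsIdeal (h : M.IsTwistedAut φ ψ) {t : TensorAlgebra k V}
    (ht : t ∈ M.nicholsIdeal) : tMap φ t ∈ M.nicholsIdeal := by
  refine h.symm.isHopfIdeal_ker.le ?_
  rwa [RingHom.mem_ker, AlgHom.comp_apply, tMap_symm_tMap, NicholsAlgebra.mk_eq_zero]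

/-- The algebra endomorphism of `𝔅(V)` induced by a twisted automorphism of `V`. -/
def nicholsMap (h : M.IsTwistedAut φ ψ) : M.NicholsAlgebra →ₐ[k] M.NicholsAlgebra :=
  NicholsAlgebra.lift M ((NicholsAlgebra.mk M).comp (tMap φ)) fun _ ht =>
    (NicholsAlgebra.mk_eq_zero M _).2 (h.tMap_mem_nicholsIdeal ht)

@[simp]
theorem nicholsMap_ι (h : M.IsTwistedAut φ ψ) (v : V) :
    h.nicholsMap (NicholsAlgebra.ι M v) = NicholsAlgebra.ι M (φ v) :=
  congrArg (NicholsAlgebra.mk M) (tMap_ι φ v)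

/-- The algebra endomorphism of `𝔅(V) # kΓ` induced by a twisted automorphism of `V`. -/
def bosonizationMap (h : M.IsTwistedAut φ ψ) : M.Bosonization →ₐ[k] M.Bosonization :=
  Bosonization.lift ((Bosonization.ofNichols M).comp h.nicholsMap)
    ((Bosonization.ofGroup M).comp ψ.toMonoidHom) fun γ v => by
      simp [Bosonization.ofGroup_mul_ofNichols, NicholsAlgebra.smul_ι, h.map_act]

@[simp]
theorem bosonizationMap_ofGroup (h : M.IsTwistedAut φ ψ) (γ : Γ) :
    h.bosonizationMap (Bosonization.ofGroup M γ) = Bosonization.ofGroup M (ψ γ) := by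
  simp [bosonizationMap]

@[simp]
theorem bosonizationMap_ι (h : M.IsTwistedAut φ ψ) (v : V) :
    h.bosonizationMap (Bosonization.ofNichols M (NicholsAlgebra.ι M v)) =
      Bosonization.ofNichols M (NicholsAlgebra.ι M (φ v)) := by
  simp [bosonizationMap]

theorem bosonizationMap_symm_comp (h : M.IsTwistedAut φ ψ) :
    h.symm.bosonizationMap.comp h.bosonizationMap = AlgHom.id k _ :=
  Bosonization.hom_ext M (fun γ => by simp) (fun g v _ => by simp)

theorem counitHom_comp_bosonizationMap (h : M.IsTwistedAut φ ψ) :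
    (Bosonization.counitHom M).comp h.bosonizationMap = Bosonization.counitHom M :=
  Bosonization.hom_ext M (fun γ => by simp [Bosonization.counitHom_ofGroup])
    (fun g v _ => by simp [Bosonization.counitHom_ι])

theorem map_comp_comulHom_bosonizationMap (h : M.IsTwistedAut φ ψ) :
    (Algebra.TensorProduct.map h.bosonizationMap h.bosonizationMap).comp
      (Bosonization.comulHom M) = (Bosonization.comulHom M).comp h.bosonizationMap :=
  Bosonization.hom_ext M (fun γ => by simp [Bosonization.comulHom_ofGroup])
    (fun g v hv => by
      simp [Bosonization.comulHom_ι M hv, Bosonization.comulHom_ι M (h.coact_homogeneous hv)])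

/-- The bialgebra automorphism of `𝔅(V) # kΓ` induced by a twisted automorphism of `V`. -/
def bosonizationEquiv (h : M.IsTwistedAut φ ψ) : M.Bosonization ≃ₐc[k] M.Bosonization :=
  BialgEquiv.ofAlgEquiv
    (AlgEquiv.ofAlgHom h.bosonizationMap h.symm.bosonizationMap h.symm.bosonizationMap_symm_comp
      h.bosonizationMap_symm_comp)
    h.counitHom_comp_bosonizationMap h.map_comp_comulHom_bosonizationMap

@[simp]
theorem bosonizationEquiv_ofGroup (h : M.IsTwistedAut φ ψ) (γ : Γ) :
    h.bosonizationEquiv (Bosonization.ofGroup M γ) = Bosonization.ofGroup M (ψ γ) :=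
  h.bosonizationMap_ofGroup γ

@[simp]
theorem bosonizationEquiv_ι (h : M.IsTwistedAut φ ψ) (v : V) :
    h.bosonizationEquiv (Bosonization.ofNichols M (NicholsAlgebra.ι M v)) =
      Bosonization.ofNichols M (NicholsAlgebra.ι M (φ v)) :=
  h.bosonizationMap_ι v

end IsTwistedAut

/-! ### Automorphisms of the bosonization -/

namespace Bosonization

variable {M : YDModule k Γ V}

theorem bialgEquiv_ext {Φ Φ' : M.Bosonization ≃ₐc[k] M.Bosonization}
    (hΓ : ∀ γ, Φ (ofGroup M γ) = Φ' (ofGroup M γ))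
    (hV : ∀ v, Φ (ofNichols M (NicholsAlgebra.ι M v)) = Φ' (ofNichols M (NicholsAlgebra.ι M v))) :
    Φ = Φ' := by
  have h : (Φ : M.Bosonization ≃ₐ[k] M.Bosonization).toAlgHom =
      (Φ' : M.Bosonization ≃ₐ[k] M.Bosonization).toAlgHom :=
    hom_ext M hΓ (fun _ v _ => hV v)
  exact BialgEquiv.ext fun a => DFunLike.congr_fun h a

theorem ofNichols_ι_injective (M : YDModule k Γ V) :
    Function.Injective fun v => ofNichols M (NicholsAlgebra.ι M v) :=
  (ofNichols_injective M).comp (NicholsAlgebra.ι_injective M)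

theorem exists_ofGroup_eq (Φ : M.Bosonization ≃ₐc[k] M.Bosonization) (γ : Γ) :
    ∃ γ', ofGroup M γ' = Φ (ofGroup M γ) :=
  isGroupLikeElem_iff_mem_range_ofGroup.1 ((isGroupLikeElem_ofGroup M γ).map Φ)

theorem exists_mulEquiv_ofGroup (Φ : M.Bosonization ≃ₐc[k] M.Bosonization) :
    ∃ ψ : Γ ≃* Γ, ∀ γ, Φ (ofGroup M γ) = ofGroup M (ψ γ) := by
  choose f hf using exists_ofGroup_eq Φ
  choose f' hf' using exists_ofGroup_eq Φ.symm
  have hinj := ofGroup_injective M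
  refine ⟨⟨⟨f, f', fun γ => hinj ?_, fun γ => hinj ?_⟩, fun γ γ' => hinj ?_⟩, fun γ => (hf γ).symm⟩
  · rw [hf', hf, BialgEquiv.symm_apply_apply]
  · rw [hf, hf', BialgEquiv.apply_symm_apply]
  · change ofGroup M (f (γ * γ')) = ofGroup M (f γ * f γ')
    rw [hf, map_mul, map_mul, map_mul, hf, hf]

theorem IsSkewPrimitive.map {Φ : M.Bosonization ≃ₐc[k] M.Bosonization} {ψ : Γ ≃* Γ}
    (hψ : ∀ γ, Φ (ofGroup M γ) = ofGroup M (ψ γ)) {g : Γ} {χ : Γ →* kˣ} {y : M.Bosonization}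
    (hy : IsSkewPrimitive M g χ y) :
    IsSkewPrimitive M (ψ g) (χ.comp ψ.symm.toMonoidHom) (Φ y) where
  comul_eq := by
    have h : TensorProduct.map (Φ : M.Bosonization →ₗ[k] M.Bosonization) Φ (comulHom M y) =
        comulHom M (Φ y) := CoalgHomClass.map_comp_comul_apply Φ y
    rw [← h, hy.comul_eq]
    simp [hψ]
  ofGroup_mul γ := by
    obtain ⟨γ, rfl⟩ := ψ.surjective γ
    rw [← hψ, ← map_mul, ← map_mul, hy.ofGroup_mul, map_smul]
    simp

end Bosonization

/-- `V` is spanned by homogeneous eigenvectors of nontrivial weight. -/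
def HasNontrivialWeights (M : YDModule k Γ V) : Prop :=
  Submodule.span k {v | ∃ g, ∃ χ ≠ 1, v ∈ M.component g χ} = ⊤

namespace Bosonization

variable {M : YDModule k Γ V} {Φ : M.Bosonization ≃ₐc[k] M.Bosonization} {ψ : Γ ≃* Γ}

theorem exists_mem_component_map_eq (hψ : ∀ γ, Φ (ofGroup M γ) = ofGroup M (ψ γ)) {g : Γ}
    {χ : Γ →* kˣ} (hχ : χ ≠ 1) {v : V} (hv : v ∈ M.component g χ) :
    ∃ w ∈ M.component (ψ g) (χ.comp ψ.symm.toMonoidHom),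
      ofNichols M (NicholsAlgebra.ι M w) = Φ (ofNichols M (NicholsAlgebra.ι M v)) := by
  refine (isSkewPrimitive_iff_exists_mem_component fun h => hχ (MonoidHom.ext fun γ => ?_)).1
    ((isSkewPrimitive_of_mem_component hv).map hψ)
  simpa using DFunLike.congr_fun h (ψ γ)

theorem exists_map_ι_eq (hM : M.HasNontrivialWeights)
    (Φ : M.Bosonization ≃ₐc[k] M.Bosonization) (v : V) :
    ∃ w, ofNichols M (NicholsAlgebra.ι M w) = Φ (ofNichols M (NicholsAlgebra.ι M v)) := by
  obtain ⟨ψ, hψ⟩ := exists_mulEquiv_ofGroup Φ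
  have hv : v ∈ Submodule.span k _ := hM.ge Submodule.mem_top
  induction hv using Submodule.span_induction with
  | mem v hv =>
    obtain ⟨g, χ, hχ, hv⟩ := hv
    obtain ⟨w, -, hw⟩ := exists_mem_component_map_eq hψ hχ hv
    exact ⟨w, hw⟩
  | zero => exact ⟨0, by simp only [map_zero]⟩
  | add v v' _ _ hv hv' =>
    obtain ⟨w, hw⟩ := hv
    obtain ⟨w', hw'⟩ := hv'
    exact ⟨w + w', by simp only [map_add, hw, hw']⟩
  | smul c v _ hv =>
    obtain ⟨w, hw⟩ := hv
    exact ⟨c • w, by simp only [map_smul, hw]⟩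

theorem exists_linearEquiv_ι (hM : M.HasNontrivialWeights)
    (Φ : M.Bosonization ≃ₐc[k] M.Bosonization) :
    ∃ φ : V ≃ₗ[k] V, ∀ v, Φ (ofNichols M (NicholsAlgebra.ι M v)) =
      ofNichols M (NicholsAlgebra.ι M (φ v)) := by
  choose f hf using exists_map_ι_eq hM Φ
  choose f' hf' using exists_map_ι_eq hM Φ.symm
  have hinj := ofNichols_ι_injective M
  refine ⟨⟨⟨⟨f, fun v w => hinj ?_⟩, fun c v => hinj ?_⟩, f', fun v => hinj ?_, fun v => hinj ?_⟩,
    fun v => (hf v).symm⟩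
  · simp only [map_add, hf]
  · simp only [map_smul, hf, RingHom.id_apply]
  · simp only [hf, hf', BialgEquiv.symm_apply_apply]
  · simp only [hf, hf', BialgEquiv.apply_symm_apply]

theorem isTwistedAut_of_map_eq (hM : M.HasNontrivialWeights)
    (hψ : ∀ γ, Φ (ofGroup M γ) = ofGroup M (ψ γ)) {φ : V ≃ₗ[k] V}
    (hφ : ∀ v, Φ (ofNichols M (NicholsAlgebra.ι M v)) = ofNichols M (NicholsAlgebra.ι M (φ v))) :
    M.IsTwistedAut φ ψ := by
  refine .of_span hM fun v ⟨g, χ, hχ, hv⟩ => ⟨g, χ, hv, ?_⟩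
  obtain ⟨w, hw, h⟩ := exists_mem_component_map_eq hψ hχ hv
  rw [hφ] at h
  exact ofNichols_ι_injective M h ▸ hw

theorem bosonizationEquiv_bijective (hM : M.HasNontrivialWeights) :
    Function.Bijective fun p : {p : (V ≃ₗ[k] V) × (Γ ≃* Γ) // M.IsTwistedAut p.1 p.2} =>
      p.2.bosonizationEquiv := by
  refine ⟨fun p q h => ?_, fun Φ => ?_⟩
  · refine Subtype.ext (Prod.ext (LinearEquiv.ext fun v => ofNichols_ι_injective M ?_)
      (MulEquiv.ext fun γ => ofGroup_injective M ?_))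
    · simpa using DFunLike.congr_fun h (ofNichols M (NicholsAlgebra.ι M v))
    · simpa using DFunLike.congr_fun h (ofGroup M γ)
  · obtain ⟨ψ, hψ⟩ := exists_mulEquiv_ofGroup Φ
    obtain ⟨φ, hφ⟩ := exists_linearEquiv_ι hM Φ
    exact ⟨⟨(φ, ψ), isTwistedAut_of_map_eq hM hψ hφ⟩,
      bialgEquiv_ext (fun γ => by simp [hψ]) (fun v => by simp [hφ])⟩

end Bosonization

/-! ### Diagonal Yetter-Drinfeld modules -/

section Diagonal

variable {M : YDModule k Γ V} {ι : Type*} {x : Module.Basis ι k V} {g : ι → Γ}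
  {χ : ι → Γ →* kˣ} {g' : Γ} {χ' : Γ →* kˣ} {v : V}

theorem hasNontrivialWeights_of_basis (hx : ∀ i, x i ∈ M.component (g i) (χ i))
    (hχ : ∀ i, χ i ≠ 1) : M.HasNontrivialWeights := by
  refine top_unique (x.span_eq.ge.trans (Submodule.span_mono ?_))
  rintro _ ⟨i, rfl⟩
  exact ⟨g i, χ i, hχ i, hx i⟩

theorem eq_degree_of_coord_ne_zero (hx : ∀ i, x i ∈ M.component (g i) (χ i))
    (hv : v ∈ M.component g' χ') {i : ι} (hi : x.coord i v ≠ 0) : g i = g' := by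
  classical
  have h : TensorProduct.rid k _ ((x.coord i).lTensor _ (M.coact v)) =
      x.coord i v • MonoidAlgebra.single (g i) (1 : k) := by
    refine LinearMap.congr_fun
      (f := (TensorProduct.rid k _).toLinearMap ∘ₗ (x.coord i).lTensor _ ∘ₗ M.coact)
      (g := (x.coord i).smulRight (MonoidAlgebra.single (g i) (1 : k))) (x.ext fun j => ?_) v
    rcases eq_or_ne j i with rfl | hij
    · simp [(hx j).1]
    · simp [(hx j).1, hij]
  rw [hv.1, LinearMap.lTensor_tmul, TensorProduct.rid_tmul] at h
  by_contra hne
  have h' := congrArg (fun a => a.coeff g') h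
  exact hi (by simpa [MonoidAlgebra.coeff_single, hne] using h')

theorem eq_weight_of_coord_ne_zero (hx : ∀ i, x i ∈ M.component (g i) (χ i))
    (hv : v ∈ M.component g' χ') {i : ι} (hi : x.coord i v ≠ 0) : χ i = χ' := by
  classical
  ext γ
  have h : x.coord i (M.act γ v) = χ i γ * x.coord i v := by
    refine LinearMap.congr_fun (f := x.coord i ∘ₗ M.act γ) (g := (χ i γ : k) • x.coord i)
      (x.ext fun j => ?_) v
    rcases eq_or_ne j i with rfl | hij
    · simp [(hx j).2]
    · simp [(hx j).2, hij]
  rw [hv.2, map_smul, smul_eq_mul] at h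
  exact (mul_right_cancel₀ hi h).symm

theorem exists_eq_smul_of_mem_component (hx : ∀ i, x i ∈ M.component (g i) (χ i))
    (hgχ : Function.Injective fun i => (g i, χ i)) (hv : v ∈ M.component g' χ') (hv0 : v ≠ 0) :
    ∃ (i : ι) (c : kˣ), v = (c : k) • x i ∧ g i = g' ∧ χ i = χ' := by
  classical
  obtain ⟨i, hi⟩ : ∃ i, x.coord i v ≠ 0 := by
    by_contra! h
    exact hv0 (x.forall_coord_eq_zero_iff.1 h)
  have hgi := eq_degree_of_coord_ne_zero hx hv hi
  have hχi := eq_weight_of_coord_ne_zero hx hv hi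
  refine ⟨i, Units.mk0 _ hi, x.ext_elem fun j => ?_, hgi, hχi⟩
  rcases eq_or_ne j i with rfl | hij
  · simp
  · have hj : x.coord j v = 0 := by
      by_contra hj
      have hgj := eq_degree_of_coord_ne_zero hx hv hj
      have hχj := eq_weight_of_coord_ne_zero hx hv hj
      exact hij (hgχ (Prod.ext (hgj.trans hgi.symm) (hχj.trans hχi.symm)))
    rw [x.coord_apply] at hj
    simp [hj, hij.symm]

theorem IsTwistedAut.exists_map_basis_eq {φ : V ≃ₗ[k] V} {ψ : Γ ≃* Γ} (h : M.IsTwistedAut φ ψ)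
    (hx : ∀ i, x i ∈ M.component (g i) (χ i)) (hgχ : Function.Injective fun i => (g i, χ i))
    (i : ι) : ∃ (c : kˣ) (j : ι),
      φ (x i) = (c : k) • x j ∧ ψ (g i) = g j ∧ χ i = (χ j).comp ψ.toMonoidHom := by
  obtain ⟨j, c, hj, hg, hχ⟩ := exists_eq_smul_of_mem_component hx hgχ
    (h.map_mem_component (hx i)) (φ.map_ne_zero_iff.2 (x.ne_zero i))
  refine ⟨c, j, hj, hg.symm, MonoidHom.ext fun γ => ?_⟩
  simp [hχ]

theorem isTwistedAut_iff_of_basis (hx : ∀ i, x i ∈ M.component (g i) (χ i))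
    (hgχ : Function.Injective fun i => (g i, χ i)) {φ : V ≃ₗ[k] V} {ψ : Γ ≃* Γ} :
    M.IsTwistedAut φ ψ ↔ ∃ (lam : ι → kˣ) (σ : Equiv.Perm ι),
      (∀ i, φ (x i) = (lam i : k) • x (σ i)) ∧ (∀ i, ψ (g i) = g (σ i)) ∧
        ∀ i, χ i = (χ (σ i)).comp ψ.toMonoidHom := by
  refine ⟨fun h => ?_, fun ⟨lam, σ, hφ, hg, hχ⟩ => .of_span x.span_eq ?_⟩
  · choose lam s hφ hg hχ using h.exists_map_basis_eq hx hgχ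
    choose _ s' _ hg' hχ' using h.symm.exists_map_basis_eq hx hgχ
    have hs's i : s' (s i) = i := hgχ (Prod.ext (by simp [← hg, ← hg'])
      (MonoidHom.ext fun γ => by simp [hχ i, hχ' (s i)]))
    have hss' i : s (s' i) = i := hgχ (Prod.ext (by simp [← hg, ← hg'])
      (MonoidHom.ext fun γ => by simp [hχ (s' i), hχ' i]))
    exact ⟨lam, ⟨s, s', hs's, hss'⟩, hφ, hg, hχ⟩
  · rintro _ ⟨i, rfl⟩
    refine ⟨g i, χ i, hx i, ?_⟩
    have hχi : (χ i).comp ψ.symm.toMonoidHom = χ (σ i) := by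
      ext γ; simp [hχ i]
    rw [hφ, hg, hχi]
    exact Submodule.smul_mem _ _ (hx _)

end Diagonal

end

end YDModule

theorem theorem1p2_general {k Γ V ι : Type*} [Field k] [CommGroup Γ] [AddCommGroup V] [Module k V]
    (M : YDModule k Γ V) (x : Module.Basis ι k V) (g : ι → Γ) (χ : ι → Γ →* kˣ)
    (h_act : ∀ (γ : Γ) (j : ι), M.act γ (x j) = (χ j γ : k) • x j)
    (h_coact : ∀ j : ι, M.coact (x j) = MonoidAlgebra.single (g j) 1 ⊗ₜ[k] x j)
    (h_ne : ∀ i, χ i ≠ 1)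
    (h_distinct : ∀ i j, i ≠ j → (g i, χ i) ≠ (g j, χ j)) :
    ∃ e : (M.Bosonization ≃ₐc[k] M.Bosonization) ≃
        {p : (V ≃ₗ[k] V) × (Γ ≃* Γ) //
          ∃ (lam : ι → kˣ) (σ : Equiv.Perm ι),
            (∀ i, p.1 (x i) = (lam i : k) • x (σ i)) ∧
            (∀ i, p.2 (g i) = g (σ i)) ∧
            (∀ i, χ i = (χ (σ i)).comp p.2.toMonoidHom)},
      ∀ Φ : M.Bosonization ≃ₐc[k] M.Bosonization,
        (∀ v : V,
          Φ (SkewMonoidAlgebra.single 1 (YDModule.NicholsAlgebra.ι M v)) =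
            SkewMonoidAlgebra.single 1 (YDModule.NicholsAlgebra.ι M ((e Φ).1.1 v))) ∧
        (∀ γ : Γ,
          Φ (SkewMonoidAlgebra.single γ 1) = SkewMonoidAlgebra.single ((e Φ).1.2 γ) 1) := by
  have hx : ∀ i, x i ∈ M.component (g i) (χ i) := fun i => ⟨h_coact i, fun γ => h_act γ i⟩
  have hgχ : Function.Injective fun i => (g i, χ i) := fun i j => not_imp_not.1 (h_distinct i j)
  let e := Equiv.ofBijective _
    (YDModule.Bosonization.bosonizationEquiv_bijective
      (YDModule.hasNontrivialWeights_of_basis hx h_ne))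
  refine ⟨e.symm.trans (Equiv.subtypeEquivRight fun p =>
    YDModule.isTwistedAut_iff_of_basis hx hgχ), fun Φ => ?_⟩
  obtain ⟨p, rfl⟩ := e.surjective Φ
  simp only [Equiv.trans_apply, Equiv.symm_apply_apply]
  exact ⟨p.2.bosonizationEquiv_ι, p.2.bosonizationEquiv_ofGroup⟩

theorem theorem1p2 {k Γ V : Type*} [Field k] [CommGroup Γ] [AddCommGroup V] [Module k V]
    (M : YDModule k Γ V) (n : ℕ) (x : Module.Basis (Fin n) k V)
    (g : Fin n → Γ) (χ : Fin n → Γ →* kˣ)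
    (h_act : ∀ (γ : Γ) (j : Fin n), M.act γ (x j) = (χ j γ : k) • x j)
    (h_coact : ∀ j : Fin n, M.coact (x j) = MonoidAlgebra.single (g j) 1 ⊗ₜ[k] x j)
    (h_ne : ∀ i, χ i ≠ 1)
    (h_distinct : ∀ i j, i ≠ j → (g i, χ i) ≠ (g j, χ j)) :
    ∃ e : (M.Bosonization ≃ₐc[k] M.Bosonization) ≃
        {p : (V ≃ₗ[k] V) × (Γ ≃* Γ) //
          ∃ (lam : Fin n → kˣ) (σ : Equiv.Perm (Fin n)),
            (∀ i, p.1 (x i) = (lam i : k) • x (σ i)) ∧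
            (∀ i, p.2 (g i) = g (σ i)) ∧
            (∀ i, χ i = (χ (σ i)).comp p.2.toMonoidHom)},
      ∀ Φ : M.Bosonization ≃ₐc[k] M.Bosonization,
        (∀ v : V,
          Φ (SkewMonoidAlgebra.single 1 (YDModule.NicholsAlgebra.ι M v)) =
            SkewMonoidAlgebra.single 1 (YDModule.NicholsAlgebra.ι M ((e Φ).1.1 v))) ∧
        (∀ γ : Γ,
          Φ (SkewMonoidAlgebra.single γ 1) = SkewMonoidAlgebra.single ((e Φ).1.2 γ) 1) :=
  theorem1p2_general M x g χ h_act h_coact h_ne h_distinct
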